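/- **Setting.** Let $Y=(0,1]^3$ and $Y^\star=(-\pi,\pi]^3$. Let $D$ be a nonempty open set (the union of finitely many separated inclusions) with closure contained in the interior of $Y$ and with boundary of class $C^{1,\gamma}$ for some $\gamma>0$, such that the host $H=Y\setminus D$ is connected. For $\alpha\in Y^\star$ let $L^2_\#(\alpha)$ be the Hilbert space of fields $\mathbf u\in L^2_{loc}(\mathbb R^3,\mathbb C^3)$ with $\mathbf u(x+p)=e^{i\alpha\cdot p}\mathbf u(x)$ for $p\in\mathbb Z^3$, with inner product $(\mathbf u,\mathbf v)=\int_Y\mathbf u\cdot\overline{\mathbf v}\,dx$. Let $J_\#(\alpha)$ be the space of all $\mathbf u\in L^2_\#(\alpha)\cap H^1_{loc}(\mathbb R^3,\mathbb C^3)$ with $\nabla\cdot\mathbf u=0$ and, if $\alpha=0$, $\int_Y\mathbf u\,dx=0$; it is a Hilbert space for $\langle\mathbf u,\mathbf w\rangle=\int_Y\nabla\times\mathbf u\cdot\overline{\nabla\times\mathbf w}\,dx$. For $k\in\mathbb C$ put $$B_k(\mathbf u,\mathbf w)=k\int_H\nabla\times\mathbf u\cdot\overline{\nabla\times\mathbf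 w}\,dx+\int_D\nabla\times\mathbf u\cdot\overline{\nabla\times\mathbf w}\,dx ,$$ and let $T_k^\alpha$ be the bounded operator on $J_\#(\alpha)$ with $\langle T_k^\alpha\mathbf u,\mathbf w\rangle=B_k(\mathbf u,\mathbf w)$. The Bloch eigenvalue problem for $\nabla\times(k\chi_H+\chi_D)\nabla\times$ is: find $\xi\in\mathbb C$ and $0\ne\mathbf h\in J_\#(\alpha)$ with $B_k(\mathbf h,\mathbf w)=\xi(\mathbf h,\mathbf w)$ for all $\mathbf w\in J_\#(\alpha)$; the solutions $\mathbf h$, together with $0$, form the eigenspace of $\xi$, and its dimension is the multiplicity of $\xi$. Let $T^\alpha$ be the quasi-static resonance operator on $J_\#(\alpha)$, given by $\langle T^\alpha\mathbf u,\mathbf w\rangle=\frac12\int_H\nabla\times\mathbf u\cdot\overline{\nabla\times\mathbf w}\,dx-\frac12\int_D\nabla\times\mathbf u\cdot\overline{\nabla\times\mathbf w}\,dx$. It equals $\frac12$ on $W_1^\alpha=\{\mathbf u:\nabla\times\mathbf u=0\text{ in }D\}$ and $-\frac12$ on $W_2^\alpha=\{\mathbf u:\nabla\times\mathbf u=0\text{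 in }H\}$, and it leaves $W_3^\alpha=(W_1^\alpha\oplus W_2^\alpha)^\perp$ invariant. Put $$Z=Z(\alpha)=\Big\{\tfrac{\mu-1/2}{\mu+1/2}:\ \mu\in\sigma(T^\alpha;W_3^\alpha)\cup\{\tfrac12\},\ \mu\neq-\tfrac12\Big\}.$$ Let $(-\Delta_\alpha)^{-1}:L^2_\#(\alpha)\to J_\#(\alpha)$ be the bounded operator with $\langle(-\Delta_\alpha)^{-1}\mathbf f,\mathbf w\rangle=(\mathbf f,\mathbf w)$ for all $\mathbf w\in J_\#(\alpha)$. **Theorem.** For each $\alpha\in Y^\star$ the Bloch eigenvalue problem extends to complex coupling constants $k\in\mathbb C\setminus Z$, where $Z\subset(-\infty,0]$, in the following sense. There are numbers $\gamma_j(k,\alpha)\in\mathbb C$, $j\in\mathbb N$, such that for every $k\in\mathbb C\setminus Z$: 1. $T_k^\alpha$ has a bounded inverse on $J_\#(\alpha)$, the operator $B^\alpha(k)=(T_k^\alpha)^{-1}(-\Delta_\alpha)^{-1}$ on $L^2_\#(\alpha)$ is compact, and $B^\alpha$ is holomorphic near $k$. 2. $\gamma_j(k,\alpha)\to0$ as $j\to\infty$,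 and the nonzero points of the spectrum of $B^\alpha(k)$ are exactly the nonzero $\gamma_j(k,\alpha)$. 3. $0$ is not a Bloch eigenvalue; for $\xi\ne0$ the eigenspace of the Bloch eigenvalue problem for $\xi$ is the eigenspace of $B^\alpha(k)$ for $\xi^{-1}$. 4. Every Bloch eigenvalue has finite multiplicity, and the Bloch eigenvalues, each repeated according to its multiplicity, are exactly the numbers $\lambda_j(k,\alpha)=\gamma_j(k,\alpha)^{-1}$ with $\gamma_j(k,\alpha)\neq0$. 5. If $k>0$, then $\gamma_j(k,\alpha)>0$ for all $j$, so that there are infinitely many Bloch eigenvalues $\lambda_j(k,\alpha)$, all positive. -/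

import Mathlib

noncomputable section

namespace BlochWaves

open MeasureTheory Set Filter Topology Complex
open scoped ContDiff NNReal ComplexConjugate

/-! ### Fields on the unit cell -/

/-- Physical space. -/
abbrev E3 := EuclideanSpace ℝ (Fin 3)

/-- Values of the fields, with the Hermitian norm. -/
abbrev C3 := EuclideanSpace ℂ (Fin 3)

/-- The unit period cell `Y = (0,1]³`. -/
def cell : Set E3 := {x | ∀ i, 0 < x i ∧ x i ≤ 1}

/-- The first Brillouin zone `Y* = (-π, π]³`. -/
def brillouinZone : Set E3 := {α | ∀ i, -Real.pi < α i ∧ α i ≤ Real.pi}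

/-- The space `L²_#(α, Y, ℂ³)`.  An `α`-quasiperiodic field in `L²_loc` is determined by its
restriction to the cell, and every element of `L²(Y, ℂ³)` is such a restriction (see `qpExt`);
the inner product is that of `L²(Y, ℂ³)`. -/
abbrev L2Y := Lp C3 2 (volume.restrict cell)

/-- The lattice point with integer coordinates `m`. -/
def latticeVec (m : Fin 3 → ℤ) : E3 := WithLp.toLp 2 fun i => (m i : ℝ)

/-- The lattice point `m` such that `x - m` lies in the cell. -/
def cellIndex (x : E3) : Fin 3 → ℤ := fun i => ⌈x i⌉ - 1

/-- The Bloch phase `exp(i α · m)`. -/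
def phase (α : E3) (m : Fin 3 → ℤ) : ℂ := cexp (I * ((∑ i, α i * m i : ℝ) : ℂ))

/-- The `α`-quasiperiodic extension to `ℝ³` of a field on the cell:
`h (x + m) = exp(i α · m) h x` for `x` in the cell and `m` in `ℤ³`. -/
def qpExt (α : E3) (f : E3 → C3) (x : E3) : C3 :=
  phase α (cellIndex x) • f (x - latticeVec (cellIndex x))

/-- `g` is the weak partial derivative `∂u/∂x_j` on `ℝ³`, both fields being extended
`α`-quasiperiodically. -/
def HasWeakPartial (α : E3) (u : L2Y) (j : Fin 3) (g : L2Y) : Prop :=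
  ∀ φ : E3 → ℂ, ContDiff ℝ ∞ φ → HasCompactSupport φ →
    ∫ x, fderiv ℝ φ x (EuclideanSpace.single j 1) • qpExt α u x = - ∫ x, φ x • qpExt α g x

/-! ### Unfolding of integrals over `ℝ³` -/

theorem measurableSet_cell : MeasurableSet cell := by
  have : cell = ⋂ i, {x : E3 | 0 < x i ∧ x i ≤ 1} := by ext; simp [cell]
  rw [this]
  refine MeasurableSet.iInter fun i => ?_
  have : Measurable fun x : E3 => x i := by fun_prop
  exact (measurableSet_lt measurable_const this).inter (measurableSet_le this measurable_const)

theorem volume_cell_lt_top : volume cell < ⊤ := by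
  refine (Bornology.IsBounded.measure_lt_top (μ := volume) ?_)
  refine (Metric.isBounded_closedBall (x := (0 : E3)) (r := 2)).subset fun x hx => ?_
  rw [mem_closedBall_zero_iff, EuclideanSpace.norm_eq, Real.sqrt_le_left (by norm_num),
    Fin.sum_univ_three]
  have h : ∀ i, ‖x i‖ ^ 2 ≤ 1 := fun i => by
    rw [Real.norm_eq_abs, sq_abs]; nlinarith [(hx i).1, (hx i).2]
  linarith [h 0, h 1, h 2]

instance isFiniteMeasure_cell : IsFiniteMeasure (volume.restrict cell : Measure E3) :=
  ⟨by simpa using volume_cell_lt_top⟩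

theorem cellIndex_add {y : E3} (hy : y ∈ cell) (m : Fin 3 → ℤ) :
    cellIndex (y + latticeVec m) = m := by
  ext i
  have h1 : ⌈y i⌉ = 1 := by
    rw [Int.ceil_eq_iff]; exact ⟨by simpa using (hy i).1, by simpa using (hy i).2⟩
  simp [cellIndex, latticeVec, h1]

theorem preimage_cell (m : Fin 3 → ℤ) :
    (fun y => y + latticeVec m) ⁻¹' {x | cellIndex x = m} = cell := by
  ext y
  simp only [mem_preimage, mem_ofPred_eq]
  refine ⟨fun h i => ?_, fun h => cellIndex_add h m⟩
  have h1 := congrFun h i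
  simp only [cellIndex, latticeVec, PiLp.add_apply, Int.ceil_add_intCast] at h1
  have h2 : ⌈y i⌉ = 1 := by omega
  rw [Int.ceil_eq_iff] at h2
  exact ⟨by simpa using h2.1, by simpa using h2.2⟩

theorem measurableSet_index (m : Fin 3 → ℤ) : MeasurableSet {x : E3 | cellIndex x = m} := by
  have : {x : E3 | cellIndex x = m} = ⋂ i, {x : E3 | ⌈x i⌉ - 1 = m i} := by
    ext x; simp [cellIndex, funext_iff]
  rw [this]
  refine MeasurableSet.iInter fun i => ?_
  have h : Measurable fun x : E3 => ⌈x i⌉ - 1 := by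
    have : Measurable fun x : E3 => x i := by fun_prop
    exact (Int.measurable_ceil.comp this).sub_const 1
  exact h (measurableSet_singleton (m i))

/-- The sum of the phase-twisted translates of `φ`. -/
def fold (α : E3) (S : Finset (Fin 3 → ℤ)) (φ : E3 → ℂ) (y : E3) : ℂ :=
  ∑ m ∈ S, phase α m * φ (y + latticeVec m)

theorem integrable_mul_field {φ : E3 → ℂ} (hφ : Continuous φ) {C : ℝ} (hC : ∀ x, ‖φ x‖ ≤ C)
    (f : L2Y) : Integrable (fun x => φ x • f x) (volume.restrict cell) :=
  ((Lp.memLp f).integrable (by norm_num)).bdd_smul C hφ.aestronglyMeasurable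
    (Eventually.of_forall hC)

theorem integral_unfold (α : E3) (S : Finset (Fin 3 → ℤ)) {φ : E3 → ℂ} (hφ : Continuous φ)
    (hc : HasCompactSupport φ) (hS : ∀ x, φ x ≠ 0 → cellIndex x ∈ S) (f : L2Y) :
    ∫ x, φ x • qpExt α f x = ∫ y in cell, fold α S φ y • f y := by
  obtain ⟨C, hC⟩ := hc.exists_bound_of_continuous hφ
  have hmp : ∀ m, MeasurePreserving (fun y : E3 => y + latticeVec m) volume volume :=
    fun m => measurePreserving_add_right volume (latticeVec m)
  have hemb : ∀ m, MeasurableEmbedding (fun y : E3 => y + latticeVec m) :=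
    fun m => measurableEmbedding_addRight (latticeVec m)
  have hval : ∀ m, ∀ y ∈ cell, φ (y + latticeVec m) • qpExt α f (y + latticeVec m)
      = (phase α m * φ (y + latticeVec m)) • f y := by
    intro m y hy
    rw [qpExt, cellIndex_add hy, add_sub_cancel_right, smul_smul, mul_comm]
  have hint' : ∀ m, Integrable (fun y => (phase α m * φ (y + latticeVec m)) • f y)
      (volume.restrict cell) := by
    intro m
    have h := integrable_mul_field (φ := fun y => φ (y + latticeVec m))
      (hφ.comp (continuous_add_const _)) (fun x => hC _) f
    refine (h.smul (phase α m)).congr (Eventually.of_forall fun y => ?_)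
    simp [smul_smul]
  have hint : ∀ m ∈ S, IntegrableOn (fun x => φ x • qpExt α f x) {x | cellIndex x = m} := by
    intro m _
    rw [← (hmp m).integrableOn_comp_preimage (hemb m), preimage_cell]
    exact (hint' m).congr
      ((ae_restrict_iff' measurableSet_cell).2 (Eventually.of_forall fun y hy => (hval m y hy).symm))
  have h1 : ∫ x, φ x • qpExt α f x
      = ∫ x in ⋃ m ∈ S, {x | cellIndex x = m}, φ x • qpExt α f x := by
    refine (setIntegral_eq_integral_of_forall_compl_eq_zero fun x hx => ?_).symm
    by_cases h : φ x = 0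
    · simp [h]
    · exact absurd (by simpa using hS x h) hx
  rw [h1, integral_biUnion_finset S (fun m _ => measurableSet_index m) ?_ hint]
  · simp only [fold, Finset.sum_smul]
    rw [integral_finsetSum S (fun m _ => hint' m)]
    refine Finset.sum_congr rfl fun m _ => ?_
    rw [← (hmp m).setIntegral_preimage_emb (hemb m), preimage_cell]
    exact setIntegral_congr_fun measurableSet_cell fun y hy => hval m y hy
  · intro m _ m' _ hne
    refine Set.disjoint_left.2 fun x hx hx' => hne ?_
    simp only [mem_ofPred_eq] at hx hx'
    rw [← hx, hx']

theorem exists_finset {φ : E3 → ℂ} (hc : HasCompactSupport φ) :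
    ∃ S : Finset (Fin 3 → ℤ), ∀ x ∈ tsupport φ, cellIndex x ∈ S := by
  obtain ⟨R, hR⟩ := hc.isBounded.exists_norm_le
  refine ⟨Fintype.piFinset fun _ => Finset.Icc (-⌈R⌉ - 1) ⌈R⌉, fun x hx => ?_⟩
  rw [Fintype.mem_piFinset]
  intro i
  have h1 : |x i| ≤ R := (PiLp.norm_apply_le x i).trans (hR x hx)
  rw [abs_le] at h1
  have h2 : ⌈x i⌉ ≤ ⌈R⌉ := Int.ceil_mono h1.2
  have h3 : -⌈R⌉ ≤ ⌈x i⌉ := by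
    have : (-⌈R⌉ : ℝ) ≤ ⌈x i⌉ := by linarith [Int.le_ceil R, Int.le_ceil (x i)]
    exact_mod_cast this
  simp only [cellIndex, Finset.mem_Icc]
  omega

/-- Pairing of a test function with a field, tested against a constant vector, is an `L²`
inner product. -/
theorem exists_repr (α : E3) {φ : E3 → ℂ} (hφ : Continuous φ) (hc : HasCompactSupport φ) (v : C3) :
    ∃ a : L2Y, ∀ f : L2Y, inner ℂ v (∫ x, φ x • qpExt α f x) = inner ℂ a f := by
  obtain ⟨S, hS⟩ := exists_finset hc
  obtain ⟨C, hC⟩ := hc.exists_bound_of_continuous hφ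
  have hcont : Continuous (fold α S φ) := by
    unfold fold
    exact continuous_finsetSum _ fun m _ =>
      continuous_const.mul (hφ.comp (continuous_add_const _))
  have hbd : ∀ y, ‖fold α S φ y‖ ≤ ∑ m ∈ S, ‖phase α m‖ * C := fun y => by
    refine (norm_sum_le _ _).trans (Finset.sum_le_sum fun m _ => ?_)
    rw [norm_mul]
    exact mul_le_mul_of_nonneg_left (hC _) (norm_nonneg _)
  have hmem : MemLp (fun y => conj (fold α S φ y) • v) 2 (volume.restrict cell) := by
    refine MemLp.of_bound (by fun_prop) ((∑ m ∈ S, ‖phase α m‖ * C) * ‖v‖)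
      (Eventually.of_forall fun y => ?_)
    rw [norm_smul, RCLike.norm_conj]
    exact mul_le_mul_of_nonneg_right (hbd y) (norm_nonneg _)
  refine ⟨hmem.toLp _, fun f => ?_⟩
  rw [integral_unfold α S hφ hc (fun x hx => hS x (subset_tsupport _ hx)) f, L2.inner_def,
    ← integral_inner (integrable_mul_field hcont hbd f) v]
  refine integral_congr_ae ?_
  filter_upwards [hmem.coeFn_toLp] with y hy
  rw [hy, inner_smul_left, inner_smul_right, RCLike.conj_conj]

theorem continuous_partial {φ : E3 → ℂ} (hφ : ContDiff ℝ ∞ φ) (j : Fin 3) :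
    Continuous fun x => fderiv ℝ φ x (EuclideanSpace.single j 1) :=
  (hφ.continuous_fderiv (by simp)).clm_apply continuous_const

theorem hasCompactSupport_partial {φ : E3 → ℂ} (hc : HasCompactSupport φ) (j : Fin 3) :
    HasCompactSupport fun x => fderiv ℝ φ x (EuclideanSpace.single j 1) :=
  hc.fderiv_apply ℝ _

/-- The weak derivative relation as a family of linear closed conditions. -/
theorem hasWeakPartial_iff (α : E3) (j : Fin 3) :
    ∃ (ι : Type) (a b : ι → L2Y), ∀ u g : L2Y,
      HasWeakPartial α u j g ↔ ∀ t, inner ℂ (a t) u = - inner ℂ (b t) g := by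
  let ι := {φ : E3 → ℂ // ContDiff ℝ ∞ φ ∧ HasCompactSupport φ} × C3
  choose a ha using fun t : ι => exists_repr α (continuous_partial t.1.2.1 j)
    (hasCompactSupport_partial t.1.2.2 j) t.2
  choose b hb using fun t : ι => exists_repr α t.1.2.1.continuous t.1.2.2 t.2
  refine ⟨ι, a, b, fun u g => ⟨fun h t => ?_, fun h φ hφ hc => ?_⟩⟩
  · rw [← ha, ← hb, h t.1.1 t.1.2.1 t.1.2.2, inner_neg_right]
  · refine ext_inner_left ℂ fun v => ?_
    have := h ⟨⟨φ, hφ, hc⟩, v⟩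
    rw [← ha, ← hb] at this
    rw [inner_neg_right]
    exact this

/-! ### Fourier coefficients -/

/-- The shifted dual lattice vector `2πn + α`. -/
def freq (α : E3) (n : Fin 3 → ℤ) : E3 := WithLp.toLp 2 fun i => 2 * Real.pi * n i + α i

/-- The conjugate plane wave `exp(-i (2πn + α) · x)`. -/
def conjWave (α : E3) (n : Fin 3 → ℤ) (x : E3) : ℂ :=
  cexp (-(I * ((∑ i, freq α n i * x i : ℝ) : ℂ)))

/-- The Fourier coefficients of an `α`-quasiperiodic field. -/
def coef (α : E3) (f : E3 → C3) (n : Fin 3 → ℤ) : C3 := ∫ x in cell, conjWave α n x • f x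

section Parseval

open UnitAddTorus

local instance : MeasureSpace UnitAddCircle := ⟨AddCircle.haarAddCircle⟩

/-- The unit cell in coordinates. -/
def cube : Set (Fin 3 → ℝ) := {x | ∀ i, x i ∈ Ioc (0 : ℝ) (0 + 1)}

theorem parseval_cube (h : (Fin 3 → ℝ) → ℂ) (hh : MemLp h 2 (volume.restrict cube)) :
    HasSum (fun n : Fin 3 → ℤ =>
        ‖∫ x in cube, mFourier (-n) (fun i => (x i : UnitAddCircle)) • h x‖ ^ 2)
      (∫ x in cube, ‖h x‖ ^ 2) := by
  have hc : MeasurableSet cube := MeasurableSet.univ_pi' (fun i => measurableSet_Ioc)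
  set e := measurableEquivPiIoc (fun _ : Fin 3 => (0:ℝ)) with he
  have hmp := measurePreserving_equivPiIoc (fun _ : Fin 3 => (0:ℝ))
  have h1 : MemLp (fun y : {x : Fin 3 → ℝ // ∀ i, x i ∈ Ioc (0:ℝ) (0 + 1)} => h y.1) 2
      (Measure.comap Subtype.val volume) := by
    have : MeasurePreserving (Subtype.val : {x : Fin 3 → ℝ // ∀ i, x i ∈ Ioc (0:ℝ) (0 + 1)} → _)
      (Measure.comap Subtype.val volume) (volume.restrict cube) :=
      ⟨measurable_subtype_coe, map_comap_subtype_coe hc volume⟩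
    exact hh.comp_measurePreserving this
  have h2 := h1.comp_measurePreserving hmp
  set F : UnitAddTorus (Fin 3) → ℂ := fun t => h (e t).1 with hF
  have h2' : MemLp F 2 volume := h2
  have key := hasSum_sq_mFourierCoeff (h2'.toLp F)
  have hFx : ∀ x ∈ cube, F (fun i => (x i : UnitAddCircle)) = h x := by
    intro x hx
    have : e.symm ⟨x, hx⟩ = fun i => (x i : UnitAddCircle) := rfl
    rw [hF, ← this]
    simp only [MeasurableEquiv.apply_symm_apply]
  have e1 : (∫ t, ‖(h2'.toLp F) t‖ ^ 2) = ∫ x in cube, ‖h x‖ ^ 2 := by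
    have : (∫ t, ‖(h2'.toLp F) t‖ ^ 2) = ∫ t, ‖F t‖ ^ 2 :=
      integral_congr_ae (by filter_upwards [h2'.coeFn_toLp] with t ht; rw [ht])
    rw [this, integral_preimage (fun t => ‖F t‖ ^ 2) (fun _ => (0:ℝ))]
    exact setIntegral_congr_fun hc (fun x hx => by simp only [hFx x hx])
  have e2 : ∀ n, mFourierCoeff (h2'.toLp F) n =
      ∫ x in cube, mFourier (-n) (fun i => (x i : UnitAddCircle)) • h x := by
    intro n
    have : mFourierCoeff (h2'.toLp F) n = mFourierCoeff F n :=
      integral_congr_ae (by filter_upwards [h2'.coeFn_toLp] with t ht; simp only [ht])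
    rw [this, mFourierCoeff_eq_integral F n (fun _ => (0:ℝ))]
    exact setIntegral_congr_fun hc (fun x hx => by simp only [hFx x hx])
  rw [e1] at key
  simpa only [e2] using key

theorem parseval_scalar (α : E3) (f : E3 → ℂ) (hf : MemLp f 2 (volume.restrict cell)) :
    HasSum (fun n : Fin 3 → ℤ => ‖∫ x in cell, conjWave α n x * f x‖ ^ 2)
      (∫ x in cell, ‖f x‖ ^ 2) := by
  have hpre : (WithLp.toLp 2 : (Fin 3 → ℝ) → E3) ⁻¹' cell = cube := by
    ext x; simp [cell, cube]
  have hmp : MeasurePreserving (WithLp.toLp 2 : (Fin 3 → ℝ) → E3) volume volume :=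
    PiLp.volume_preserving_toLp (Fin 3)
  have hemb : MeasurableEmbedding (WithLp.toLp 2 : (Fin 3 → ℝ) → E3) :=
    (MeasurableEquiv.toLp 2 (Fin 3 → ℝ)).measurableEmbedding
  have hmp' := hmp.restrict_preimage measurableSet_cell
  rw [hpre] at hmp'
  let q : E3 → ℂ := fun x => cexp (-(I * ((∑ i, α i * x i : ℝ) : ℂ)))
  have hq : Continuous q := by fun_prop
  have hqn : ∀ x, ‖q x‖ = 1 := fun x => by
    simp only [q]
    rw [show -(I * ((∑ i, α i * x i : ℝ) : ℂ)) = ((-(∑ i, α i * x i) : ℝ) : ℂ) * I by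
      push_cast; ring, norm_exp_ofReal_mul_I]
  have hg : MemLp (fun x => q x * f x) 2 (volume.restrict cell) := by
    refine hf.of_le (hq.aestronglyMeasurable.mul hf.1) (Eventually.of_forall fun x => ?_)
    rw [norm_mul, hqn, one_mul]
  have key := parseval_cube _ (hg.comp_measurePreserving hmp')
  have e1 : ∫ x in cube, ‖((fun x => q x * f x) ∘ WithLp.toLp 2) x‖ ^ 2
      = ∫ x in cell, ‖f x‖ ^ 2 := by
    rw [← hpre, ← hmp.setIntegral_preimage_emb hemb]
    simp [hqn]
  have e2 : ∀ n : Fin 3 → ℤ, ∫ x in cube, mFourier (-n) (fun i => (x i : UnitAddCircle)) •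
      ((fun x => q x * f x) ∘ WithLp.toLp 2) x = ∫ x in cell, conjWave α n x * f x := by
    intro n
    rw [← hpre, ← hmp.setIntegral_preimage_emb hemb]
    refine integral_congr_ae (Eventually.of_forall fun x => ?_)
    simp only [Function.comp, smul_eq_mul, ← mul_assoc]
    congr 1
    simp only [mFourier, ContinuousMap.coe_mk, fourier_coe_apply, q, conjWave, freq,
      ← Complex.exp_sum, ← Complex.exp_add]
    congr 1
    push_cast
    rw [Finset.mul_sum, Finset.mul_sum, ← Finset.sum_neg_distrib, ← Finset.sum_neg_distrib,
      ← Finset.sum_add_distrib]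
    refine Finset.sum_congr rfl fun i _ => ?_
    simp
    ring
  rw [e1] at key
  simpa only [e2] using key

end Parseval

theorem norm_conjWave (α : E3) (n : Fin 3 → ℤ) (x : E3) : ‖conjWave α n x‖ = 1 := by
  rw [conjWave, show -(I * ((∑ i, freq α n i * x i : ℝ) : ℂ))
    = ((-(∑ i, freq α n i * x i) : ℝ) : ℂ) * I by push_cast; ring, norm_exp_ofReal_mul_I]

theorem contDiff_conjWave (α : E3) (n : Fin 3 → ℤ) : ContDiff ℝ ∞ (conjWave α n) := by
  unfold conjWave
  have h1 : ContDiff ℝ ∞ fun x : E3 => ∑ i, freq α n i * x i := by fun_prop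
  have h2 : ContDiff ℝ ∞ fun x : E3 => ((∑ i, freq α n i * x i : ℝ) : ℂ) :=
    ofRealCLM.contDiff.comp h1
  exact (contDiff_const.mul h2).neg.cexp

theorem integrable_conjWave (α : E3) (n : Fin 3 → ℤ) (f : L2Y) :
    Integrable (fun x => conjWave α n x • f x) (volume.restrict cell) :=
  integrable_mul_field (contDiff_conjWave α n).continuous
    (fun x => (norm_conjWave α n x).le) f

/-- Parseval's identity for `α`-quasiperiodic fields. -/
theorem hasSum_coef (α : E3) (f : L2Y) : HasSum (fun n => ‖coef α f n‖ ^ 2) (‖f‖ ^ 2) := by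
  have hf : ∀ i, MemLp (fun x => f x i) 2 (volume.restrict cell) := fun i =>
    (Lp.memLp f).continuousLinearMap_comp (EuclideanSpace.proj (𝕜 := ℂ) i)
  have h1 : ∀ n i, coef α f n i = ∫ x in cell, conjWave α n x * f x i := fun n i => by
    have := (EuclideanSpace.proj (𝕜 := ℂ) i : C3 →L[ℂ] ℂ).integral_comp_comm
      (integrable_conjWave α n f)
    simpa [coef] using this.symm
  have h2 : ‖f‖ ^ 2 = ∑ i, ∫ x in cell, ‖f x i‖ ^ 2 := by
    rw [← integral_finsetSum _ (fun i _ => by simpa using (hf i).integrable_norm_pow (by norm_num)),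
      ← Complex.ofReal_inj]
    have h3 := inner_self_eq_norm_sq_to_K (𝕜 := ℂ) f
    rw [L2.inner_def] at h3
    simp only [inner_self_eq_norm_sq_to_K] at h3
    have h4 : ∫ a in cell, (((‖f a‖ ^ 2 : ℝ)) : ℂ) = ((∫ a in cell, ‖f a‖ ^ 2 : ℝ) : ℂ) :=
      integral_ofReal
    push_cast at h3 h4 ⊢
    simp only [coe_algebraMap] at h3
    rw [← h3, h4]
    simp only [EuclideanSpace.norm_sq_eq]
  rw [h2]
  simp only [EuclideanSpace.norm_sq_eq, h1]
  exact hasSum_sum fun i _ => parseval_scalar α _ (hf i)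

/-- A smooth compactly supported function on the line whose integer translates sum to one. -/
def bump (t : ℝ) : ℝ := Real.smoothTransition (t + 1) - Real.smoothTransition t

theorem abs_le_of_bump_ne_zero {t : ℝ} (h : bump t ≠ 0) : |t| ≤ 1 := by
  by_contra hc
  rw [not_le, lt_abs] at hc
  apply h
  rcases hc with hc | hc
  · rw [bump, Real.smoothTransition.one_of_one_le (by linarith),
      Real.smoothTransition.one_of_one_le (by linarith), sub_self]
  · rw [bump, Real.smoothTransition.zero_of_nonpos (by linarith),
      Real.smoothTransition.zero_of_nonpos (by linarith), sub_self]

/-- A smooth compactly supported function on `ℝ³` whose lattice translates sum to one. -/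
def cutoff (x : E3) : ℝ := ∏ i, bump (x i)

/-- The lattice points needed to unfold `cutoff`. -/
def nearIndices : Finset (Fin 3 → ℤ) := Fintype.piFinset fun _ => {-2, -1, 0}

theorem contDiff_cutoff : ContDiff ℝ ∞ cutoff := by
  unfold cutoff bump
  refine contDiff_prod fun i _ => ContDiff.sub ?_ ?_
  · exact Real.smoothTransition.contDiff.comp (by fun_prop)
  · exact Real.smoothTransition.contDiff.comp (by fun_prop)

theorem cutoff_ne_zero {x : E3} (h : cutoff x ≠ 0) (i : Fin 3) : |x i| ≤ 1 :=
  abs_le_of_bump_ne_zero (Finset.prod_ne_zero_iff.1 h i (Finset.mem_univ i))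

theorem index_of_abs_le {x : E3} (h : ∀ i, |x i| ≤ 1) : cellIndex x ∈ nearIndices := by
  rw [nearIndices, Fintype.mem_piFinset]
  intro i
  have h1 := abs_le.1 (h i)
  have h2 : ⌈x i⌉ ≤ 1 := Int.ceil_le.2 (by simpa using h1.2)
  have h3 : (-1 : ℤ) ≤ ⌈x i⌉ := by
    have : ((-1 : ℤ) : ℝ) ≤ ⌈x i⌉ := by push_cast; linarith [Int.le_ceil (x i)]
    exact_mod_cast this
  simp only [cellIndex, Finset.mem_insert, Finset.mem_singleton]
  omega

theorem sum_cutoff (y : E3) : ∑ m ∈ nearIndices, cutoff (y + latticeVec m)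
    = ∏ i, (Real.smoothTransition (y i + 1) - Real.smoothTransition (y i - 2)) := by
  have := Finset.prod_univ_sum (fun _ : Fin 3 => ({-2, -1, 0} : Finset ℤ))
    (fun i k => bump (y i + k))
  rw [nearIndices]
  simp only [cutoff, latticeVec, PiLp.add_apply]
  rw [← this]
  refine Finset.prod_congr rfl fun i _ => ?_
  rw [Finset.sum_insert (by decide), Finset.sum_insert (by decide), Finset.sum_singleton]
  simp only [bump]
  push_cast
  rw [show y i + -2 + 1 = y i - 1 by ring, show y i + -1 + 1 = y i by ring,
    show y i + -2 = y i - 2 by ring, show y i + -1 = y i - 1 by ring, add_zero]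
  ring

theorem sum_cutoff_le (y : E3) : ∑ m ∈ nearIndices, cutoff (y + latticeVec m) ≤ 1 := by
  rw [sum_cutoff]
  refine Finset.prod_le_one (fun i _ => ?_) fun i _ => ?_
  · exact sub_nonneg.2 (Real.smoothTransition.monotone (by linarith))
  · linarith [Real.smoothTransition.le_one (y i + 1), Real.smoothTransition.nonneg (y i - 2)]

theorem sum_cutoff_eq {y : E3} (hy : y ∈ cell) :
    ∑ m ∈ nearIndices, cutoff (y + latticeVec m) = 1 := by
  rw [sum_cutoff]
  refine Finset.prod_eq_one fun i _ => ?_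
  rw [Real.smoothTransition.one_of_one_le (by linarith [(hy i).1]),
    Real.smoothTransition.zero_of_nonpos (by linarith [(hy i).2]), sub_zero]

theorem sum_fderiv_cutoff {y : E3} (hy : y ∈ cell) :
    ∑ m ∈ nearIndices, fderiv ℝ cutoff (y + latticeVec m) = 0 := by
  have hd : Differentiable ℝ cutoff := contDiff_cutoff.differentiable (by simp)
  have h1 : fderiv ℝ (fun z => ∑ m ∈ nearIndices, cutoff (z + latticeVec m)) y
      = ∑ m ∈ nearIndices, fderiv ℝ cutoff (y + latticeVec m) := by
    rw [fderiv_fun_sum]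
    · exact Finset.sum_congr rfl fun m _ => fderiv_comp_add_right (latticeVec m)
    · intro m _
      exact (hd.comp (differentiable_id.add_const _)).differentiableAt
  rw [← h1]
  refine IsLocalMax.fderiv_eq_zero (Eventually.of_forall fun z => ?_)
  simp only [sum_cutoff_eq hy]
  exact sum_cutoff_le z

theorem partial_conjWave (α : E3) (n : Fin 3 → ℤ) (x : E3) (j : Fin 3) :
    fderiv ℝ (conjWave α n) x (EuclideanSpace.single j 1)
      = -(I * freq α n j) * conjWave α n x := by
  let L : E3 →L[ℝ] ℝ := ∑ i, freq α n i • (EuclideanSpace.proj i : E3 →L[ℝ] ℝ)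
  have hL : conjWave α n = fun x => cexp (-(I * ofRealCLM (L x))) := by
    funext x; simp [conjWave, L]
  have h1 : HasFDerivAt (fun x : E3 => -(I * ofRealCLM (L x)))
      (-(I • (ofRealCLM ∘L L))) x :=
    (((ofRealCLM ∘L L).hasFDerivAt).const_mul I).neg
  rw [hL, h1.cexp.fderiv]
  simp [L, mul_comm]

theorem phase_mul_conjWave (α : E3) (n m : Fin 3 → ℤ) (y : E3) :
    phase α m * conjWave α n (y + latticeVec m) = conjWave α n y := by
  rw [phase, conjWave, conjWave, ← Complex.exp_add, Complex.exp_eq_exp_iff_exists_int]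
  refine ⟨-∑ i, n i * m i, ?_⟩
  simp only [latticeVec, freq, Fin.sum_univ_three, PiLp.add_apply]
  push_cast
  ring

/-- The Fourier coefficients of a weak partial derivative. -/
theorem coef_weakPartial {α : E3} {u g : L2Y} {j : Fin 3} (h : HasWeakPartial α u j g)
    (n : Fin 3 → ℤ) : coef α g n = (I * freq α n j) • coef α u n := by
  let φ : E3 → ℂ := fun x => (cutoff x : ℂ) * conjWave α n x
  have hcs : ContDiff ℝ ∞ fun x => (cutoff x : ℂ) := ofRealCLM.contDiff.comp contDiff_cutoff
  have hφ : ContDiff ℝ ∞ φ := hcs.mul (contDiff_conjWave α n)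
  have hzero : ∀ x, φ x ≠ 0 → ∀ i, |x i| ≤ 1 := fun x hx =>
    cutoff_ne_zero fun h0 => hx (by simp [φ, h0])
  have hclosed : IsClosed {x : E3 | ∀ i, |x i| ≤ 1} := by
    simp only [ofPred_forall]
    exact isClosed_iInter fun i => isClosed_le (by fun_prop) continuous_const
  have hts : ∀ x ∈ tsupport φ, ∀ i, |x i| ≤ 1 := fun x hx =>
    closure_minimal (fun x hx => hzero x hx) hclosed hx
  have hc : HasCompactSupport φ := by
    refine HasCompactSupport.intro (isCompact_closedBall (0 : E3) 2) fun x hx => ?_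
    by_contra h0
    apply hx
    rw [mem_closedBall_zero_iff, EuclideanSpace.norm_eq, Real.sqrt_le_left (by norm_num),
      Fin.sum_univ_three]
    have h : ∀ i, ‖x i‖ ^ 2 ≤ 1 := fun i => by
      rw [Real.norm_eq_abs]; nlinarith [hzero x h0 i, abs_nonneg (x i)]
    linarith [h 0, h 1, h 2]
  have hpd : ∀ x, fderiv ℝ φ x (EuclideanSpace.single j 1)
      = ((fderiv ℝ cutoff x (EuclideanSpace.single j 1) : ℝ) : ℂ) * conjWave α n x
        - (I * freq α n j) * ((cutoff x : ℂ) * conjWave α n x) := by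
    intro x
    have h1 : HasFDerivAt (fun x => (cutoff x : ℂ)) (ofRealCLM ∘L fderiv ℝ cutoff x) x :=
      (ofRealCLM.hasFDerivAt).comp x
        ((contDiff_cutoff.differentiable (by simp)) x).hasFDerivAt
    have h2 := ((contDiff_conjWave α n).differentiable (by simp) x).hasFDerivAt
    have h3 := (h1.mul h2).fderiv
    change fderiv ℝ φ x = _ at h3
    rw [h3]
    simp only [add_apply, smul_apply,
      partial_conjWave, ContinuousLinearMap.comp_apply, ofRealCLM_apply, smul_eq_mul]
    ring
  have hS1 : ∀ x, φ x ≠ 0 → cellIndex x ∈ nearIndices := fun x hx =>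
    index_of_abs_le (hzero x hx)
  have hS2 : ∀ x, fderiv ℝ φ x (EuclideanSpace.single j 1) ≠ 0 → cellIndex x ∈ nearIndices :=
    fun x hx => index_of_abs_le (hts x (support_fderiv_subset ℝ (fun h0 => hx (by
      rw [h0]; rfl))))
  have key := h φ hφ hc
  rw [integral_unfold α nearIndices hφ.continuous hc hS1 g,
    integral_unfold α nearIndices (continuous_partial hφ j) (hasCompactSupport_partial hc j)
      hS2 u] at key
  have e1 : ∀ y ∈ cell, fold α nearIndices φ y = conjWave α n y := by
    intro y hy
    have : ∀ m, phase α m * φ (y + latticeVec m)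
        = (cutoff (y + latticeVec m) : ℂ) * conjWave α n y := fun m => by
      rw [← phase_mul_conjWave α n m y]; simp only [φ]; ring
    simp only [fold, this, ← Finset.sum_mul]
    rw [← ofReal_sum, sum_cutoff_eq hy, ofReal_one, one_mul]
  have e2 : ∀ y ∈ cell, fold α nearIndices (fun x => fderiv ℝ φ x (EuclideanSpace.single j 1)) y
      = -(I * freq α n j) * conjWave α n y := by
    intro y hy
    have : ∀ m, phase α m * fderiv ℝ φ (y + latticeVec m) (EuclideanSpace.single j 1)
        = ((fderiv ℝ cutoff (y + latticeVec m) (EuclideanSpace.single j 1) : ℝ) : ℂ)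
            * conjWave α n y
          - (cutoff (y + latticeVec m) : ℂ) * ((I * freq α n j) * conjWave α n y) := fun m => by
      rw [← phase_mul_conjWave α n m y, hpd]; ring
    simp only [fold, this, Finset.sum_sub_distrib, ← Finset.sum_mul]
    have h0 : ∑ m ∈ nearIndices,
        fderiv ℝ cutoff (y + latticeVec m) (EuclideanSpace.single j 1) = 0 := by
      rw [← sum_apply, sum_fderiv_cutoff hy]; rfl
    rw [← ofReal_sum, ← ofReal_sum, sum_cutoff_eq hy, h0]
    simp
  have k1 : ∫ y in cell, fold α nearIndices φ y • g y = coef α g n :=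
    setIntegral_congr_fun measurableSet_cell fun y hy => by simp only [e1 y hy]
  have k2 : ∫ y in cell,
      fold α nearIndices (fun x => fderiv ℝ φ x (EuclideanSpace.single j 1)) y • u y
        = (-(I * freq α n j)) • coef α u n := by
    rw [coef, ← integral_smul]
    exact setIntegral_congr_fun measurableSet_cell fun y hy => by simp only [e2 y hy, mul_smul]
  rw [k1, k2, neg_smul, neg_inj] at key
  exact key.symm

/-! ### The space `J_#(α, Y, ℂ³)` -/

theorem ae_div_iff (g : Fin 3 → L2Y) :
    (∀ᵐ x ∂(volume.restrict cell), ∑ j, g j x j = 0) ↔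
      (∑ j, (EuclideanSpace.proj (𝕜 := ℂ) j : C3 →L[ℂ] ℂ).compLpL 2 (volume.restrict cell) (g j)
        : Lp ℂ 2 (volume.restrict cell)) = 0 := by
  have h : ∀ᵐ x ∂(volume.restrict cell), (∑ j, (EuclideanSpace.proj (𝕜 := ℂ) j :
      C3 →L[ℂ] ℂ).compLpL 2 (volume.restrict cell) (g j) : Lp ℂ 2 (volume.restrict cell)) x
        = ∑ j, g j x j := by
    have hj : ∀ j : Fin 3, ∀ᵐ x ∂(volume.restrict cell), ((EuclideanSpace.proj (𝕜 := ℂ) j :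
        C3 →L[ℂ] ℂ).compLpL 2 (volume.restrict cell) (g j)) x = g j x j := fun j =>
      (EuclideanSpace.proj (𝕜 := ℂ) j : C3 →L[ℂ] ℂ).coeFn_compLpL (g j)
    rw [Fin.sum_univ_three]
    filter_upwards [hj 0, hj 1, hj 2, Lp.coeFn_add
      ((EuclideanSpace.proj (𝕜 := ℂ) 0 : C3 →L[ℂ] ℂ).compLpL 2 (volume.restrict cell) (g 0)
      + (EuclideanSpace.proj (𝕜 := ℂ) 1 : C3 →L[ℂ] ℂ).compLpL 2 (volume.restrict cell) (g 1))
      ((EuclideanSpace.proj (𝕜 := ℂ) 2 : C3 →L[ℂ] ℂ).compLpL 2 (volume.restrict cell) (g 2)),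
      Lp.coeFn_add
      ((EuclideanSpace.proj (𝕜 := ℂ) 0 : C3 →L[ℂ] ℂ).compLpL 2 (volume.restrict cell) (g 0))
      ((EuclideanSpace.proj (𝕜 := ℂ) 1 : C3 →L[ℂ] ℂ).compLpL 2 (volume.restrict cell) (g 1))]
      with x h0 h1 h2 h3 h4
    rw [h3, Pi.add_apply, h4, Pi.add_apply, h0, h1, h2, Fin.sum_univ_three]
  rw [Lp.eq_zero_iff_ae_eq_zero]
  constructor
  · intro h0
    filter_upwards [h, h0] with x hx hx0
    rw [hx, hx0, Pi.zero_apply]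
  · intro h0
    filter_upwards [h, h0] with x hx hx0
    rw [← hx, hx0, Pi.zero_apply]

theorem exists_mean : ∃ c : C3 → L2Y, ∀ f : L2Y,
    (∫ x in cell, f x = 0) ↔ ∀ v, inner ℂ (c v) f = 0 := by
  have hm : ∀ v : C3, MemLp (fun _ : E3 => v) 2 (volume.restrict cell) := fun v => memLp_const v
  refine ⟨fun v => (hm v).toLp _, fun f => ?_⟩
  have h1 : ∀ v, inner ℂ ((hm v).toLp _) f = inner ℂ v (∫ x in cell, f x) := fun v => by
    rw [L2.inner_def, ← integral_inner ((Lp.memLp f).integrable (by norm_num)) v]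
    refine integral_congr_ae ?_
    filter_upwards [(hm v).coeFn_toLp] with y hy
    rw [hy]
  simp only [h1]
  exact ⟨fun h v => by rw [h, inner_zero_right], fun h => ext_inner_left ℂ fun v => by
    rw [h, inner_zero_right]⟩

/-- The conditions defining `J_#(α, Y, ℂ³)` for a field `p.1` together with its weak gradient
`p.2`: the field is `α`-quasiperiodic with locally square integrable weak first derivatives, it is
divergence free, and it has zero mean when `α = 0`. -/
def IsAdmissible (α : E3) (p : L2Y × (Fin 3 → L2Y)) : Prop :=
  (∀ j, HasWeakPartial α p.1 j (p.2 j)) ∧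
    (∀ᵐ x ∂(volume.restrict cell), ∑ j, p.2 j x j = 0) ∧
    (α = 0 → ∫ x in cell, p.1 x = 0)

theorem isAdmissible_iff (α : E3) : ∃ (ι : Type) (a b : Fin 3 → ι → L2Y) (c : C3 → L2Y),
    ∀ p : L2Y × (Fin 3 → L2Y), IsAdmissible α p ↔
      (∀ j t, inner ℂ (a j t) p.1 = - inner ℂ (b j t) (p.2 j)) ∧
      (∑ j, (EuclideanSpace.proj (𝕜 := ℂ) j : C3 →L[ℂ] ℂ).compLpL 2 (volume.restrict cell) (p.2 j)
        : Lp ℂ 2 (volume.restrict cell)) = 0 ∧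
      (α = 0 → ∀ v, inner ℂ (c v) p.1 = 0) := by
  choose ι a b h using hasWeakPartial_iff α
  obtain ⟨c, hc⟩ := exists_mean
  refine ⟨Σ j, ι j, fun j t => if e : t.1 = j then a j (e ▸ t.2) else 0,
    fun j t => if e : t.1 = j then b j (e ▸ t.2) else 0, c, fun p => ?_⟩
  rw [IsAdmissible, ae_div_iff, hc]
  refine and_congr (forall_congr' fun j => ?_) Iff.rfl
  rw [h]
  constructor
  · rintro h1 ⟨j', t⟩
    by_cases e : j' = j
    · subst e; simpa using h1 t
    · simp [e]
  · intro h1 t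
    simpa using h1 ⟨j, t⟩

/-- The pairs consisting of a field in `J_#(α, Y, ℂ³)` and its weak gradient.  The weak gradient is
determined by the field, so this is a copy of `J_#(α, Y, ℂ³)`. -/
def admissible (α : E3) : Submodule ℂ (L2Y × (Fin 3 → L2Y)) where
  carrier := {p | IsAdmissible α p}
  zero_mem' := by
    obtain ⟨ι, a, b, c, h⟩ := isAdmissible_iff α
    refine (h 0).2 ⟨fun j t => by simp, by simp, fun _ v => by simp⟩
  add_mem' := by
    obtain ⟨ι, a, b, c, h⟩ := isAdmissible_iff α
    intro p q hp hq
    have hp := (h p).1 hp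
    have hq := (h q).1 hq
    refine (h _).2 ⟨fun j t => ?_, ?_, fun h0 v => ?_⟩
    · simp only [Prod.fst_add, Prod.snd_add, Pi.add_apply, inner_add_right, hp.1, hq.1]
      ring
    · simp only [Prod.snd_add, Pi.add_apply, map_add, Finset.sum_add_distrib, hp.2.1, hq.2.1,
        add_zero]
    · simp only [Prod.fst_add, inner_add_right, hp.2.2 h0, hq.2.2 h0, add_zero]
  smul_mem' := by
    obtain ⟨ι, a, b, c, h⟩ := isAdmissible_iff α
    intro r p hp
    have hp := (h p).1 hp
    refine (h _).2 ⟨fun j t => ?_, ?_, fun h0 v => ?_⟩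
    · simp only [Prod.smul_fst, Prod.smul_snd, Pi.smul_apply, inner_smul_right, hp.1]
      ring
    · simp only [Prod.smul_snd, Pi.smul_apply, map_smul, ← Finset.smul_sum, hp.2.1, smul_zero]
    · simp only [Prod.smul_fst, inner_smul_right, hp.2.2 h0, mul_zero]

theorem isClosed_admissible (α : E3) : IsClosed (admissible α : Set (L2Y × (Fin 3 → L2Y))) := by
  obtain ⟨ι, a, b, c, h⟩ := isAdmissible_iff α
  have h1 : IsClosed {p : L2Y × (Fin 3 → L2Y) |
      ∀ j t, inner ℂ (a j t) p.1 = - inner ℂ (b j t) (p.2 j)} := by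
    simp only [ofPred_forall]
    exact isClosed_iInter fun j => isClosed_iInter fun t =>
      isClosed_eq (by fun_prop) (by fun_prop)
  have h2 : IsClosed {p : L2Y × (Fin 3 → L2Y) |
      (∑ j, (EuclideanSpace.proj (𝕜 := ℂ) j : C3 →L[ℂ] ℂ).compLpL 2 (volume.restrict cell) (p.2 j)
        : Lp ℂ 2 (volume.restrict cell)) = 0} := isClosed_eq (by fun_prop) continuous_const
  have h3 : IsClosed {p : L2Y × (Fin 3 → L2Y) | α = 0 → ∀ v, inner ℂ (c v) p.1 = 0} := by
    simp only [ofPred_forall]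
    exact isClosed_iInter fun _ => isClosed_iInter fun v =>
      isClosed_eq (by fun_prop) continuous_const
  have h4 : (admissible α : Set (L2Y × (Fin 3 → L2Y))) = _ ∩ (_ ∩ _) := Set.ext h
  rw [h4]
  exact h1.inter (h2.inter h3)

/-- The cross product `e_j × v` with a coordinate vector. -/
def crossBasis (j : Fin 3) : C3 →L[ℂ] C3 :=
  LinearMap.toContinuousLinearMap
    ((WithLp.linearEquiv 2 ℂ (Fin 3 → ℂ)).symm.toLinearMap ∘ₗ
      crossProduct (Pi.single j (1 : ℂ)) ∘ₗ (WithLp.linearEquiv 2 ℂ (Fin 3 → ℂ)).toLinearMap)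

/-- The curl `∇ × u = ∑_j e_j × ∂_j u`, computed from the gradient. -/
def curlOfGrad : (Fin 3 → L2Y) →L[ℂ] L2Y :=
  ∑ j, (crossBasis j).compLpL 2 (volume.restrict cell) ∘L ContinuousLinearMap.proj j

theorem crossBasis_zero (v : C3) : crossBasis 0 v = !₂[0, -v 2, v 1] := by
  ext i; fin_cases i <;> simp [crossBasis, cross_apply]

theorem crossBasis_one (v : C3) : crossBasis 1 v = !₂[v 2, 0, -v 0] := by
  ext i; fin_cases i <;> simp [crossBasis, cross_apply]

theorem crossBasis_two (v : C3) : crossBasis 2 v = !₂[-v 1, v 0, 0] := by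
  ext i; fin_cases i <;> simp [crossBasis, cross_apply]

/-- The curl in coordinates. -/
theorem curlOfGrad_ae (g : Fin 3 → L2Y) : ∀ᵐ x ∂(volume.restrict cell),
    curlOfGrad g x = !₂[g 1 x 2 - g 2 x 1, g 2 x 0 - g 0 x 2, g 0 x 1 - g 1 x 0] := by
  have h : curlOfGrad g = (crossBasis 0).compLpL 2 (volume.restrict cell) (g 0)
      + (crossBasis 1).compLpL 2 (volume.restrict cell) (g 1)
      + (crossBasis 2).compLpL 2 (volume.restrict cell) (g 2) := by
    simp [curlOfGrad, Fin.sum_univ_three]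
  rw [h]
  filter_upwards [(crossBasis 0).coeFn_compLpL (g 0), (crossBasis 1).coeFn_compLpL (g 1),
    (crossBasis 2).coeFn_compLpL (g 2), Lp.coeFn_add
    ((crossBasis 0).compLpL 2 (volume.restrict cell) (g 0)
      + (crossBasis 1).compLpL 2 (volume.restrict cell) (g 1))
    ((crossBasis 2).compLpL 2 (volume.restrict cell) (g 2)), Lp.coeFn_add
    ((crossBasis 0).compLpL 2 (volume.restrict cell) (g 0))
    ((crossBasis 1).compLpL 2 (volume.restrict cell) (g 1))] with x h0 h1 h2 h3 h4
  rw [h3, Pi.add_apply, h4, Pi.add_apply, h0, h1, h2, crossBasis_zero, crossBasis_one,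
    crossBasis_two]
  ext i
  fin_cases i <;> simp <;> ring

/-! ### The Poincaré inequality -/

theorem coef_apply (α : E3) (f : L2Y) (n : Fin 3 → ℤ) (i : Fin 3) :
    coef α f n i = ∫ x in cell, conjWave α n x * f x i := by
  have := (EuclideanSpace.proj (𝕜 := ℂ) i : C3 →L[ℂ] ℂ).integral_comp_comm
    (integrable_conjWave α n f)
  simpa [coef] using this.symm

theorem integrable_conjWave_apply (α : E3) (f : L2Y) (n : Fin 3 → ℤ) (i : Fin 3) :
    Integrable (fun x => conjWave α n x * f x i) (volume.restrict cell) := by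
  have := (EuclideanSpace.proj (𝕜 := ℂ) i : C3 →L[ℂ] ℂ).integrable_comp
    (integrable_conjWave α n f)
  simpa using this

theorem coef_div {α : E3} {p : L2Y × (Fin 3 → L2Y)} (hp : IsAdmissible α p) (n : Fin 3 → ℤ) :
    ∑ j, freq α n j * coef α p.1 n j = 0 := by
  have h1 : ∑ j, coef α (p.2 j) n j = 0 := by
    simp only [coef_apply]
    rw [← integral_finsetSum _ (fun j _ => integrable_conjWave_apply α (p.2 j) n j)]
    refine integral_eq_zero_of_ae ?_
    filter_upwards [hp.2.1] with x hx
    rw [← Finset.mul_sum, hx, mul_zero, Pi.zero_apply]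
  have h2 : ∀ j, coef α (p.2 j) n j = I * (freq α n j * coef α p.1 n j) := fun j => by
    rw [coef_weakPartial (hp.1 j)]; simp [mul_assoc]
  simp only [h2, ← Finset.mul_sum] at h1
  simpa using h1

theorem coef_curl {α : E3} {p : L2Y × (Fin 3 → L2Y)} (hp : IsAdmissible α p) (n : Fin 3 → ℤ) :
    coef α (curlOfGrad p.2) n = I • !₂[
      freq α n 1 * coef α p.1 n 2 - freq α n 2 * coef α p.1 n 1,
      freq α n 2 * coef α p.1 n 0 - freq α n 0 * coef α p.1 n 2,
      freq α n 0 * coef α p.1 n 1 - freq α n 1 * coef α p.1 n 0] := by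
  have h2 : ∀ j i, coef α (p.2 j) n i = I * (freq α n j * coef α p.1 n i) := fun j i => by
    rw [coef_weakPartial (hp.1 j)]; simp [mul_assoc]
  have h3 : ∀ i j k l m, (∀ᵐ x ∂(volume.restrict cell),
      curlOfGrad p.2 x i = p.2 j x k - p.2 l x m) →
      coef α (curlOfGrad p.2) n i
        = I * (freq α n j * coef α p.1 n k - freq α n l * coef α p.1 n m) := by
    intro i j k l m h
    rw [mul_sub, ← h2, ← h2, coef_apply, coef_apply, coef_apply,
      ← integral_sub (integrable_conjWave_apply _ _ _ _) (integrable_conjWave_apply _ _ _ _)]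
    refine integral_congr_ae ?_
    filter_upwards [h] with x hx
    rw [hx, mul_sub]
  have hc := curlOfGrad_ae p.2
  ext i
  fin_cases i
  · simpa using h3 0 1 2 2 1 (hc.mono fun x hx => by rw [hx]; simp)
  · simpa using h3 1 2 0 0 2 (hc.mono fun x hx => by rw [hx]; simp)
  · simpa using h3 2 0 1 1 0 (hc.mono fun x hx => by rw [hx]; simp)

theorem norm_coef_curl {α : E3} {p : L2Y × (Fin 3 → L2Y)} (hp : IsAdmissible α p)
    (n : Fin 3 → ℤ) :
    ‖coef α (curlOfGrad p.2) n‖ ^ 2 = ‖freq α n‖ ^ 2 * ‖coef α p.1 n‖ ^ 2 := by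
  have hd := coef_div hp n
  rw [coef_curl hp, norm_smul, norm_I, one_mul]
  simp only [EuclideanSpace.norm_sq_eq, Fin.sum_univ_three] at hd ⊢
  generalize coef α p.1 n 0 = a at *
  generalize coef α p.1 n 1 = b at *
  generalize coef α p.1 n 2 = c at *
  generalize freq α n 0 = x at *
  generalize freq α n 1 = y at *
  generalize freq α n 2 = z at *
  have hre := congrArg re hd
  have him := congrArg im hd
  simp at hre him
  simp only [← Complex.normSq_eq_norm_sq, Complex.normSq_apply, Real.norm_eq_abs, sq_abs]
  simp
  linear_combination (-(x * a.re + y * b.re + z * c.re)) * hre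
    - (x * a.im + y * b.im + z * c.im) * him

/-- A lower bound for the frequencies that occur. -/
theorem exists_freq_bound {α : E3} (hα : α ∈ brillouinZone) : ∃ c > 0, ∀ n : Fin 3 → ℤ,
    (α = 0 → n ≠ 0) → c ≤ ‖freq α n‖ ^ 2 := by
  have hpi := Real.pi_gt_three
  by_cases h0 : α = 0
  · refine ⟨1, one_pos, fun n hn => ?_⟩
    obtain ⟨i, hi⟩ := Function.ne_iff.1 (hn h0)
    have h1 : (1 : ℝ) ≤ (n i : ℝ) ^ 2 := by
      have : (1 : ℤ) ≤ (n i) ^ 2 := by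
        have : 0 < (n i) ^ 2 := by have : n i ≠ 0 := hi; positivity
        omega
      exact_mod_cast this
    have h2 : (freq α n i) ^ 2 ≤ ‖freq α n‖ ^ 2 := by
      rw [← sq_abs, ← Real.norm_eq_abs]
      gcongr
      exact PiLp.norm_apply_le _ i
    refine le_trans ?_ h2
    simp only [freq, h0, PiLp.zero_apply, add_zero]
    have h3 : (1 : ℝ) ≤ (2 * Real.pi) ^ 2 := by nlinarith
    rw [mul_pow]
    nlinarith
  · refine ⟨‖α‖ ^ 2, by positivity, fun n _ => ?_⟩
    rw [EuclideanSpace.norm_sq_eq, EuclideanSpace.norm_sq_eq]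
    refine Finset.sum_le_sum fun i _ => ?_
    simp only [Real.norm_eq_abs, sq_abs, freq]
    obtain ⟨h1, h2⟩ := hα i
    rcases lt_trichotomy (n i) 0 with h | h | h
    · have : (n i : ℝ) ≤ -1 := by exact_mod_cast (by omega : n i ≤ -1)
      have h3 : Real.pi * n i + α i ≤ 0 := by nlinarith
      have h4 : Real.pi * n i ≤ 0 := by nlinarith
      nlinarith [mul_nonneg_of_nonpos_of_nonpos h4 h3]
    · simp [h]
    · have : (1 : ℝ) ≤ n i := by exact_mod_cast (by omega : 1 ≤ n i)
      have h3 : 0 ≤ Real.pi * n i + α i := by nlinarith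
      have h4 : 0 ≤ Real.pi * n i := by nlinarith
      nlinarith [mul_nonneg h4 h3]

/-- The field and its gradient are controlled by the curl. -/
theorem exists_poincare {α : E3} (hα : α ∈ brillouinZone) : ∃ K : ℝ≥0,
    ∀ p ∈ admissible α, ‖p‖ ≤ K * ‖curlOfGrad p.2‖ := by
  obtain ⟨c, hc, hn⟩ := exists_freq_bound hα
  refine ⟨Real.toNNReal (1 + (Real.sqrt c)⁻¹), fun p hp => ?_⟩
  have hp : IsAdmissible α p := hp
  have hsum := hasSum_coef α (curlOfGrad p.2)
  have h1 : c * ‖p.1‖ ^ 2 ≤ ‖curlOfGrad p.2‖ ^ 2 := by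
    refine hasSum_le (fun n => ?_) ((hasSum_coef α p.1).mul_left c) hsum
    rw [norm_coef_curl hp]
    by_cases h : α = 0 → n ≠ 0
    · exact mul_le_mul_of_nonneg_right (hn n h) (by positivity)
    · push Not at h
      have : coef α p.1 n = 0 := by
        rw [← hp.2.2 h.1, coef]
        refine setIntegral_congr_fun measurableSet_cell fun x _ => ?_
        simp [conjWave, freq, h.1, h.2]
      simp [this]
  have h2 : ∀ j, ‖p.2 j‖ ≤ ‖curlOfGrad p.2‖ := fun j => by
    rw [← sq_le_sq₀ (norm_nonneg _) (norm_nonneg _)]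
    refine hasSum_le (fun n => ?_) (hasSum_coef α (p.2 j)) hsum
    rw [norm_coef_curl hp, coef_weakPartial (hp.1 j), norm_smul, mul_pow]
    refine mul_le_mul_of_nonneg_right ?_ (by positivity)
    rw [norm_mul, norm_I, one_mul, Complex.norm_real]
    gcongr
    exact PiLp.norm_apply_le _ j
  have h3 : ‖p.1‖ ≤ (Real.sqrt c)⁻¹ * ‖curlOfGrad p.2‖ := by
    rw [← sq_le_sq₀ (norm_nonneg _) (by positivity), mul_pow, inv_pow, Real.sq_sqrt hc.le,
      ← div_eq_inv_mul, le_div_iff₀ hc]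
    linarith
  have hs : 0 ≤ (Real.sqrt c)⁻¹ * ‖curlOfGrad p.2‖ := by positivity
  rw [Real.coe_toNNReal _ (by positivity), add_mul, one_mul]
  refine norm_prod_le_iff.2 ⟨?_, (pi_norm_le_iff_of_nonneg (by positivity)).2 fun j => ?_⟩
  · linarith [norm_nonneg (curlOfGrad p.2)]
  · linarith [h2 j]

/-- The space `J_#(α, Y, ℂ³)` of divergence free `α`-quasiperiodic `H¹_loc` fields (of zero mean if
`α = 0`), with the inner product `⟨u, w⟩ = ∫_Y ∇×u · conj (∇×w)`. -/
def JSpace (α : brillouinZone) : Type := admissible (α : E3)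

namespace JSpace

variable {α : brillouinZone}

instance addCommGroup : AddCommGroup (JSpace α) :=
  inferInstanceAs (AddCommGroup (admissible (α : E3)))

instance module : Module ℂ (JSpace α) := inferInstanceAs (Module ℂ (admissible (α : E3)))

/-- The underlying field. -/
def field : JSpace α →ₗ[ℂ] L2Y :=
  LinearMap.fst ℂ L2Y (Fin 3 → L2Y) ∘ₗ (admissible (α : E3)).subtype

/-- The weak gradient; `grad u j` is `∂_j u`. -/
def grad : JSpace α →ₗ[ℂ] (Fin 3 → L2Y) :=
  LinearMap.snd ℂ L2Y (Fin 3 → L2Y) ∘ₗ (admissible (α : E3)).subtype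

/-- The curl of a field. -/
def curl : JSpace α →ₗ[ℂ] L2Y := curlOfGrad.toLinearMap ∘ₗ grad

theorem isAdmissible (u : JSpace α) : IsAdmissible (α : E3) (field u, grad u) := u.2

theorem exists_bound (α : brillouinZone) : ∃ K : ℝ≥0, ∀ u : JSpace α,
    ‖field u‖ ≤ K * ‖curl u‖ ∧ ‖grad u‖ ≤ K * ‖curl u‖ := by
  obtain ⟨K, hK⟩ := exists_poincare α.2
  exact ⟨K, fun u => norm_prod_le_iff.1 (hK _ u.2)⟩

theorem eq_zero_of_curl {u : JSpace α} (h : curl u = 0) : u = 0 := by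
  obtain ⟨K, hK⟩ := exists_bound α
  have := hK u
  rw [h, norm_zero, mul_zero, norm_le_zero_iff, norm_le_zero_iff] at this
  exact Subtype.ext (Prod.ext this.1 this.2)

/-- The inner product `⟨u, w⟩ = ∫_Y ∇×u · conj (∇×w)`, conjugate linear in the first argument of
`inner` as usual in Mathlib. -/
abbrev innerCore : InnerProductSpace.Core ℂ (JSpace α) where
  inner u w := inner ℂ (curl u) (curl w)
  conj_inner_symm u w := inner_conj_symm _ _
  re_inner_nonneg u := inner_self_nonneg
  add_left u v w := by simp only [map_add, inner_add_left]
  smul_left u w r := by simp only [map_smul, inner_smul_left]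
  definite u h := eq_zero_of_curl (inner_self_eq_zero.1 h)

instance normedAddCommGroup : NormedAddCommGroup (JSpace α) :=
  @InnerProductSpace.Core.toNormedAddCommGroup ℂ (JSpace α) _ _ _ innerCore

instance innerProductSpace : InnerProductSpace ℂ (JSpace α) :=
  InnerProductSpace.ofCore innerCore.toCore

theorem inner_def (u w : JSpace α) : inner ℂ u w = inner ℂ (curl u) (curl w) := rfl

theorem norm_eq (u : JSpace α) : ‖u‖ = ‖curl u‖ := by
  rw [← sq_eq_sq₀ (norm_nonneg _) (norm_nonneg _)]
  have h1 := inner_self_eq_norm_sq (𝕜 := ℂ) u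
  have h2 := inner_self_eq_norm_sq (𝕜 := ℂ) (curl u)
  rw [← h1, ← h2, inner_def]

instance completeSpace : CompleteSpace (JSpace α) := by
  obtain ⟨K, hK⟩ := exists_poincare α.2
  let e : JSpace α ≃ₗ[ℂ] admissible (α : E3) := LinearEquiv.refl ℂ (admissible (α : E3))
  let E := e.toContinuousLinearEquivOfBounds K ‖curlOfGrad‖
    (fun u => by rw [norm_eq]; exact hK _ u.2)
    (fun p => by
      rw [norm_eq]
      refine (curlOfGrad.le_opNorm _).trans ?_
      exact mul_le_mul_of_nonneg_left (norm_prod_le_iff.1 le_rfl).2 (norm_nonneg _))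
  have : CompleteSpace (admissible (α : E3)) := (isClosed_admissible (α : E3)).completeSpace_coe
  exact (completeSpace_congr (e := E.toEquiv) E.isUniformEmbedding).2 this

/-- The inclusion of `J_#(α, Y, ℂ³)` in `L²_#(α, Y, ℂ³)`. -/
def toL2 : JSpace α →L[ℂ] L2Y :=
  LinearMap.mkContinuousOfExistsBound field (by
    obtain ⟨K, hK⟩ := exists_bound α
    exact ⟨K, fun u => by rw [norm_eq]; exact (hK u).1⟩)

/-- The curl, as an isometry into `L²`. -/
def curlL : JSpace α →L[ℂ] L2Y := LinearMap.mkContinuous curl 1 fun u => by rw [norm_eq, one_mul]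

theorem toL2_apply (u : JSpace α) : toL2 u = field u := rfl

theorem curlL_apply (u : JSpace α) : curlL u = curl u := rfl

end JSpace

open JSpace

/-- The energy `∫_S ∇×u · conj (∇×w)` over a part `S` of the cell. -/
def energyOn {α : brillouinZone} (S : Set E3) (u w : JSpace α) : ℂ :=
  ∫ x in S, ∑ i, curl u x i * conj (curl w x i)

/-- The `L²` pairing `∫_Y u · conj w`. -/
def pairing {α : brillouinZone} (u w : JSpace α) : ℂ :=
  ∫ x in cell, ∑ i, field u x i * conj (field w x i)

/-- The bounded operator on `J_#(α, Y, ℂ³)` associated with the form `energyOn S`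
(see `inner_energyOp`). -/
def energyOp {α : brillouinZone} (S : Set E3) : JSpace α →L[ℂ] JSpace α :=
  let R : JSpace α →L[ℂ] Lp C3 2 ((volume.restrict cell).restrict S) :=
    LpToLpRestrictCLM E3 C3 ℂ (volume.restrict cell) 2 S ∘L curlL
  ContinuousLinearMap.adjoint R ∘L R

theorem inner_energyOp {α : brillouinZone} {S : Set E3} (hS : S ⊆ cell) (hm : MeasurableSet S)
    (u w : JSpace α) : inner ℂ w (energyOp S u) = energyOn S u w := by
  rw [energyOp, ContinuousLinearMap.comp_apply, ContinuousLinearMap.adjoint_inner_right,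
    L2.inner_def, energyOn]
  have hr : (volume.restrict cell : Measure E3).restrict S = volume.restrict S := by
    rw [Measure.restrict_restrict hm, inter_eq_left.2 hS]
  have h1 := LpToLpRestrictCLM_coeFn ℂ (μ := volume.restrict cell) S (curl u)
  have h2 := LpToLpRestrictCLM_coeFn ℂ (μ := volume.restrict cell) S (curl w)
  have h3 : ∀ᵐ x ∂((volume.restrict cell : Measure E3).restrict S),
      inner ℂ ((LpToLpRestrictCLM E3 C3 ℂ (volume.restrict cell) 2 S ∘L curlL) w x)
        ((LpToLpRestrictCLM E3 C3 ℂ (volume.restrict cell) 2 S ∘L curlL) u x)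
      = ∑ i, curl u x i * conj (curl w x i) := by
    filter_upwards [h1, h2] with x h1 h2
    simp only [ContinuousLinearMap.comp_apply, curlL_apply]
    rw [h1, h2, PiLp.inner_apply]
    simp [RCLike.inner_apply]
  rw [integral_congr_ae h3, hr]

theorem inner_toL2 {α : brillouinZone} (u w : JSpace α) :
    inner ℂ (toL2 w) (toL2 u) = pairing u w := by
  rw [L2.inner_def, pairing]
  refine integral_congr_ae (Eventually.of_forall fun x => ?_)
  simp only [toL2_apply]
  rw [PiLp.inner_apply]
  simp [RCLike.inner_apply]

/-! ### The crystal and its operators -/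

/-- The open set `D` has a boundary of class `C^{1,γ}`: near each boundary point, `D` is the
sublevel set `{ρ < 0}` of a `C¹` function `ρ` with nonvanishing `γ`-Hölder continuous
differential. -/
def HasC1HolderBoundary (γ : ℝ≥0) (D : Set E3) : Prop :=
  ∀ x ∈ frontier D, ∃ (U : Set E3) (ρ : E3 → ℝ) (C : ℝ≥0), IsOpen U ∧ x ∈ U ∧
    ContDiffOn ℝ 1 ρ U ∧ HolderOnWith C γ (fderiv ℝ ρ) U ∧
    (∀ y ∈ U, fderiv ℝ ρ y ≠ 0) ∧ (∀ y ∈ U, y ∈ D ↔ ρ y < 0)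

/-- A two-phase crystal: inclusions `D` (finitely many components, by compactness) inside the period
cell, with `C^{1,γ}` boundary, surrounded by a connected host `H = Y \ D`. -/
structure Crystal where
  /-- The union of the inclusions. -/
  inclusion : Set E3
  isOpen_inclusion : IsOpen inclusion
  nonempty_inclusion : inclusion.Nonempty
  closure_subset : closure inclusion ⊆ interior cell
  /-- The boundary regularity. -/
  boundary : ∃ γ : ℝ≥0, 0 < γ ∧ HasC1HolderBoundary γ inclusion
  connected_host : IsConnected (cell \ inclusion)

namespace Crystal

variable (c : Crystal)

/-- The host material `H`. -/
def host : Set E3 := cell \ c.inclusion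

theorem inclusion_subset : c.inclusion ⊆ cell :=
  subset_closure.trans (c.closure_subset.trans interior_subset)

theorem measurableSet_inclusion : MeasurableSet c.inclusion := c.isOpen_inclusion.measurableSet

theorem host_subset : c.host ⊆ cell := sdiff_subset

theorem measurableSet_host : MeasurableSet c.host :=
  measurableSet_cell.diff c.measurableSet_inclusion

variable (α : brillouinZone)

/-- The sesquilinear form
`B_k(u, w) = k ∫_H ∇×u · conj (∇×w) + ∫_D ∇×u · conj (∇×w)`. -/
def form (k : ℂ) (u w : JSpace α) : ℂ :=
  k * energyOn c.host u w + energyOn c.inclusion u w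

/-- The operator `T_k^α` associated with the form `B_k` (see `inner_T`). -/
def T (k : ℂ) : JSpace α →L[ℂ] JSpace α := k • energyOp c.host + energyOp c.inclusion

/-- `⟨T_k^α u, w⟩ = B_k(u, w)`; the inner product of Mathlib is linear in its second argument. -/
theorem inner_T (k : ℂ) (u w : JSpace α) : inner ℂ w (c.T α k u) = c.form α k u w := by
  rw [T, form, add_apply, smul_apply, inner_add_right, inner_smul_right,
    inner_energyOp c.host_subset c.measurableSet_host,
    inner_energyOp c.inclusion_subset c.measurableSet_inclusion]

/-- The quasi-static resonance operator `T^α`, that is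
`⟨T^α u, w⟩ = ½ ∫_H ∇×u · conj (∇×w) - ½ ∫_D ∇×u · conj (∇×w)` (see `inner_resonanceOp`). -/
def resonanceOp : JSpace α →L[ℂ] JSpace α :=
  (1 / 2 : ℂ) • energyOp c.host - (1 / 2 : ℂ) • energyOp c.inclusion

theorem inner_resonanceOp (u w : JSpace α) : inner ℂ w (c.resonanceOp α u)
    = 1 / 2 * energyOn c.host u w - 1 / 2 * energyOn c.inclusion u w := by
  rw [resonanceOp, sub_apply, smul_apply, smul_apply, inner_sub_right, inner_smul_right,
    inner_smul_right, inner_energyOp c.host_subset c.measurableSet_host,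
    inner_energyOp c.inclusion_subset c.measurableSet_inclusion]

/-- Fields whose curl vanishes in `S`. -/
def curlFreeIn (S : Set E3) (hS : S ⊆ cell) : Submodule ℂ (JSpace α) where
  carrier := {u | ∀ᵐ x ∂(volume.restrict S), curl u x = 0}
  zero_mem' := by
    have h := ae_restrict_of_ae_restrict_of_subset hS
      (Lp.coeFn_zero C3 2 (volume.restrict cell : Measure E3))
    change ∀ᵐ x ∂(volume.restrict S), curl (0 : JSpace α) x = 0
    rw [map_zero]
    exact h
  add_mem' := by
    intro u v hu hv
    change ∀ᵐ x ∂(volume.restrict S), curl (u + v) x = 0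
    rw [map_add]
    filter_upwards [hu, hv, ae_restrict_of_ae_restrict_of_subset hS
      (Lp.coeFn_add (curl u) (curl v))] with x h1 h2 h3
    rw [h3, Pi.add_apply, h1, h2, add_zero]
  smul_mem' := by
    intro r u hu
    change ∀ᵐ x ∂(volume.restrict S), curl (r • u) x = 0
    rw [map_smul]
    filter_upwards [hu, ae_restrict_of_ae_restrict_of_subset hS
      (Lp.coeFn_smul r (curl u))] with x h1 h3
    rw [h3, Pi.smul_apply, h1, smul_zero]

/-- `W₁ = {u : ∇×u = 0 in D}`. -/
def W₁ : Submodule ℂ (JSpace α) := curlFreeIn α c.inclusion c.inclusion_subset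

/-- `W₂ = {u : ∇×u = 0 in H}`. -/
def W₂ : Submodule ℂ (JSpace α) := curlFreeIn α c.host c.host_subset

/-- `W₃` is the orthogonal complement of `W₁ ⊕ W₂` in `J_#(α, Y, ℂ³)`. -/
def W₃ : Submodule ℂ (JSpace α) := (c.W₁ α ⊔ c.W₂ α)ᗮ

theorem energyOn_add (u w : JSpace α) :
    energyOn c.host u w + energyOn c.inclusion u w = inner ℂ w u := by
  have hi : IntegrableOn (fun x => ∑ i, curl u x i * conj (curl w x i)) cell := by
    refine (L2.integrable_inner (𝕜 := ℂ) (curl w) (curl u)).congr (Eventually.of_forall fun x => ?_)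
    simp [PiLp.inner_apply, RCLike.inner_apply]
  have h := setIntegral_union (μ := volume) (f := fun x => ∑ i, curl u x i * conj (curl w x i))
    (disjoint_sdiff_left (s := c.inclusion) (t := cell)) c.measurableSet_inclusion
    (hi.mono_set c.host_subset) (hi.mono_set c.inclusion_subset)
  rw [sdiff_union_of_subset c.inclusion_subset] at h
  rw [energyOn, energyOn, host, ← h, inner_def, L2.inner_def]
  refine integral_congr_ae (Eventually.of_forall fun x => ?_)
  simp [PiLp.inner_apply, RCLike.inner_apply]

theorem energyOn_eq_zero {S : Set E3} {hS : S ⊆ cell} {w : JSpace α} (hw : w ∈ curlFreeIn α S hS)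
    (u : JSpace α) : energyOn S u w = 0 := by
  refine integral_eq_zero_of_ae ?_
  have hw : ∀ᵐ x ∂(volume.restrict S), curl w x = 0 := hw
  filter_upwards [hw] with x hx
  simp [hx]

/-- `W₃` is invariant under `T^α`. -/
theorem resonanceOp_mem {u : JSpace α} (hu : u ∈ c.W₃ α) : c.resonanceOp α u ∈ c.W₃ α := by
  rw [W₃, ← Submodule.inf_orthogonal, Submodule.mem_inf, Submodule.mem_orthogonal,
    Submodule.mem_orthogonal] at hu ⊢
  refine ⟨fun w hw => ?_, fun w hw => ?_⟩
  · have h0 := energyOn_eq_zero α hw u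
    have h1 := c.energyOn_add α u w
    rw [hu.1 w hw, h0, add_zero] at h1
    rw [inner_resonanceOp, h0, h1]; simp
  · have h0 := energyOn_eq_zero α hw u
    have h1 := c.energyOn_add α u w
    rw [hu.2 w hw, h0, zero_add] at h1
    rw [inner_resonanceOp, h0, h1]; simp

/-- The restriction of `T^α` to `W₃`. -/
def resonanceOp₃ : c.W₃ α →L[ℂ] c.W₃ α :=
  (c.resonanceOp α).restrict fun _ hu => c.resonanceOp_mem α hu

/-- The set `Z` of excluded coupling constants `(μ - ½) / (μ + ½)`.  Here `μ` is in the spectrum of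
`T^α` on `W₃`, or is the eigenvalue `½` of `T^α` on `W₁`, which excludes `k = 0`.  The eigenvalue
`-½` on `W₂` corresponds to `k = ∞`. -/
def Z : Set ℂ :=
  {k | ∃ μ ∈ insert (1 / 2 : ℂ) (spectrum ℂ (c.resonanceOp₃ α)), μ ≠ -(1 / 2) ∧
    k = (μ - 1 / 2) / (μ + 1 / 2)}

/-- The operator `(-Δ_α)⁻¹ : L²_# → J_#`, that is
`⟨(-Δ_α)⁻¹ f, w⟩ = ∫_Y f · conj w` for all `w` in `J_#` (see `inner_invLaplacian`). -/
def invLaplacian : L2Y →L[ℂ] JSpace α := ContinuousLinearMap.adjoint toL2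

theorem inner_invLaplacian (f : L2Y) (w : JSpace α) :
    inner ℂ w (invLaplacian α f) = inner ℂ (toL2 w) f :=
  ContinuousLinearMap.adjoint_inner_right _ _ _

/-- The operator `B^α(k) = (T_k^α)⁻¹ (-Δ_α)⁻¹` on `L²_#(α, Y, ℂ³)`.  (`Ring.inverse` is the inverse
whenever `T_k^α` is invertible.) -/
def B (k : ℂ) : L2Y →L[ℂ] L2Y := toL2 ∘L Ring.inverse (c.T α k) ∘L invLaplacian α

/-- The space of Bloch waves with Bloch eigenvalue `ξ` for the coupling constant `k`: the fields `h`
in `J_#(α, Y, ℂ³)` with `B_k(h, w) = ξ ∫_Y h · conj w` for all `w` in `J_#(α, Y, ℂ³)`. -/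
def blochSpace (k ξ : ℂ) : Submodule ℂ (JSpace α) where
  carrier := {h | ∀ w, c.form α k h w = ξ * pairing h w}
  zero_mem' w := by simp [← inner_T, ← inner_toL2]
  add_mem' {u v} hu hv w := by
    have hu := hu w
    have hv := hv w
    simp only [← inner_T, ← inner_toL2, map_add, inner_add_right] at *
    rw [hu, hv, mul_add]
  smul_mem' r u hu w := by
    have hu := hu w
    simp only [← inner_T, ← inner_toL2, map_smul, inner_smul_right] at *
    rw [hu]; ring

end Crystal

end BlochWaves

end

/-! Let `P = energyOp c.host`. It is positive, and because host and inclusion partition the cell,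
`energyOp c.inclusion = 1 - P`. Hence `T_k = 1 + (k - 1) P` and `T^α = P - 1/2` are affine functions
of one operator with `0 ≤ P ≤ 1`. Its eigenspaces for `1` and `0` are `W₁` and `W₂`. So `T_k` is
block diagonal: it is `k` on `W₁`, `1` on `W₂`, and on `W₃` it is `(1 - k)(μ - T^α)` with `μ = 1/(1
- k) - 1/2`, the solution of `k = (μ - 1/2)/(μ + 1/2)`. Outside `Z` all three blocks are invertible
(`isUnit_T`), and `-1/2 ≤ T^α ≤ 1/2` on `W₃` places `Z` in `(-∞, 0]` (`Z_subset`).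

On divergence free fields the curl multiplies the size of the `n`-th Fourier coefficient by `|2πn +
α|`. High frequencies are therefore small in `L²` relative to the norm of `J_#`, and the embedding
`toL2` is compact (`isCompactOperator_toL2`). Hence `B^α(k)` is compact: its nonzero spectrum
consists of eigenvalues with finite dimensional eigenspaces, accumulating at most at `0`, and
`exists_enumeration` lists them with multiplicity. The weak problem reads `T_k h = ξ (-Δ_α)⁻¹ h`,
that is `B^α(k) h = ξ⁻¹ h` (`map_blochSpace`).

For `k > 0` the operator `B^α(k)` is symmetric and a Rayleigh quotient gives positive eigenvalues.
Its rank is infinite, because `J_#` contains infinitely many independent plane waves and the range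
of `(-Δ_α)⁻¹` is dense. By the spectral theorem there are infinitely many nonzero eigenvalues, and
in that case the enumeration contains no zero. -/

noncomputable section

namespace BlochWaves

open MeasureTheory Set Filter Topology Complex
open scoped ContDiff NNReal ComplexConjugate

/-! ### Compact operators on Hilbert spaces -/

section CompactOperators

open Module.End

variable {E : Type*} [NormedAddCommGroup E] [InnerProductSpace ℂ E]

/-- A compact operator has no infinite sequence of linearly independent eigenvectors whose
eigenvalues stay away from zero. -/
theorem not_linearIndependent_of_eigenvectors {T : E →L[ℂ] E} (hT : IsCompactOperator T) {ε : ℝ}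
    (hε : 0 < ε) {μ : ℕ → ℂ} (hμ : ∀ n, ε ≤ ‖μ n‖) {f : ℕ → E} (hf : ∀ n, T (f n) = μ n • f n) :
    ¬ LinearIndependent ℂ f := by
  intro hli
  set e := InnerProductSpace.gramSchmidtNormed ℂ f
  have he : Orthonormal ℂ e := InnerProductSpace.gramSchmidtNormed_orthonormal hli
  -- In the Gram–Schmidt basis `T` is upper triangular with diagonal entries `μ n`: `e n` lies in
  -- the span of the `f m` with `m ≤ n`, and `T - μ n` maps this span into that of the `f m` with `m
  -- < n`. Neither symmetry of `T` nor distinct eigenvalues are needed.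
  have h1 : ∀ n, inner ℂ (e n) (T (e n)) = μ n := by
    intro n
    have h2 : e n ∈ Submodule.span ℂ (f '' Iic n) := by
      rw [← InnerProductSpace.span_gramSchmidt_Iic, ← InnerProductSpace.span_gramSchmidtNormed]
      exact Submodule.subset_span ⟨n, mem_Iic.2 le_rfl, rfl⟩
    have h3 : T (e n) - μ n • e n ∈ Submodule.span ℂ (f '' Iio n) := by
      have : Submodule.span ℂ (f '' Iic n) ≤ (Submodule.span ℂ (f '' Iio n)).comap
          (T.toLinearMap - μ n • (LinearMap.id : E →ₗ[ℂ] E)) := by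
        rw [Submodule.span_le]
        rintro _ ⟨m, hm, rfl⟩
        have h4 : (T.toLinearMap - μ n • (LinearMap.id : E →ₗ[ℂ] E)) (f m) = (μ m - μ n) • f m := by
          simp [hf, sub_smul]
        rw [Submodule.comap_coe, mem_preimage, h4, SetLike.mem_coe]
        rcases (mem_Iic.1 hm).eq_or_lt with h | h
        · simp [h]
        · exact Submodule.smul_mem _ _ (Submodule.subset_span ⟨m, h, rfl⟩)
      exact this h2
    rw [← InnerProductSpace.span_gramSchmidt_Iio, ← InnerProductSpace.span_gramSchmidtNormed] at h3
    have h5 : inner ℂ (e n) (T (e n) - μ n • e n) = 0 := by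
      have : Submodule.span ℂ (e '' Iio n) ≤ LinearMap.ker (innerSL ℂ (e n)).toLinearMap := by
        rw [Submodule.span_le]
        rintro _ ⟨m, hm, rfl⟩
        simpa using he.2 (ne_of_gt (mem_Iio.1 hm))
      exact LinearMap.mem_ker.1 (this h3)
    rw [inner_sub_right, inner_smul_right, inner_self_eq_norm_sq_to_K, he.1 n, sub_eq_zero] at h5
    simpa using h5
  -- Along a subsequence `T (e n)` converges to some `y`, while Bessel's inequality gives `⟨e n, y⟩
  -- → 0`. The diagonal entries then tend to `0`, contradicting the lower bound `ε`.
  obtain ⟨K, hK, hK'⟩ := hT.image_closedBall_subset_compact (𝕜₁ := ℂ) (f := T.toLinearMap) 1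
  obtain ⟨y, _, ψ, hψ, hψy⟩ := hK.tendsto_subseq
    (fun n => hK' ⟨e n, by simp [he.1 n], rfl⟩)
  have h6 : Tendsto (fun n => ‖inner ℂ (e n) y‖ ^ 2) atTop (𝓝 0) := by
    have := (he.inner_products_summable (x := y)).tendsto_cofinite_zero
    rwa [Nat.cofinite_eq_atTop] at this
  have h7 : Tendsto (fun n => ‖inner ℂ (e n) y‖) atTop (𝓝 0) := by
    have := h6.sqrt
    simpa using this
  have h8 := (tendsto_iff_norm_sub_tendsto_zero.1 hψy).add (h7.comp hψ.tendsto_atTop)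
  rw [add_zero] at h8
  have h9 : ∀ n, ε ≤ ‖T (e (ψ n)) - y‖ + ‖inner ℂ (e (ψ n)) y‖ := fun n => by
    calc ε ≤ ‖inner ℂ (e (ψ n)) (T (e (ψ n)))‖ := by rw [h1]; exact hμ _
      _ = ‖inner ℂ (e (ψ n)) (T (e (ψ n)) - y) + inner ℂ (e (ψ n)) y‖ := by
        rw [← inner_add_right, sub_add_cancel]
      _ ≤ _ := (norm_add_le _ _).trans (by
        gcongr
        refine (norm_inner_le_norm _ _).trans ?_
        rw [he.1, one_mul])
  exact absurd (ge_of_tendsto' h8 h9) (not_le.2 hε)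

/-- The eigenvalues of a compact operator accumulate at most at zero. -/
theorem finite_hasEigenvalue {T : E →L[ℂ] E} (hT : IsCompactOperator T) {ε : ℝ} (hε : 0 < ε) :
    {μ : ℂ | ε ≤ ‖μ‖ ∧ HasEigenvalue T.toLinearMap μ}.Finite := by
  by_contra hinf
  have : Infinite {μ : ℂ | ε ≤ ‖μ‖ ∧ HasEigenvalue T.toLinearMap μ} :=
    Set.infinite_coe_iff.2 hinf
  let μ := Infinite.natEmbedding {μ : ℂ | ε ≤ ‖μ‖ ∧ HasEigenvalue T.toLinearMap μ}
  choose f hf using fun n => (μ n).2.2.exists_hasEigenvector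
  refine not_linearIndependent_of_eigenvectors hT hε (μ := fun n => μ n) (fun n => (μ n).2.1)
    (fun n => (hf n).apply_eq_smul) ?_
  exact eigenvectors_linearIndependent' T.toLinearMap (fun n => (μ n : ℂ))
    (Subtype.val_injective.comp μ.injective) f hf

/-- A family of multiplicities accumulating at most at zero is enumerated by a null sequence. -/
theorem exists_enumeration (d : ℂ → ℕ) (hd : ∀ ε > 0, {μ : ℂ | ε ≤ ‖μ‖ ∧ d μ ≠ 0}.Finite) :
    ∃ γ : ℕ → ℂ, Tendsto γ atTop (𝓝 0) ∧ (∀ μ ≠ 0, {j | γ j = μ}.encard = d μ) ∧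
      ((∃ j, γ j = 0) → {μ | μ ≠ 0 ∧ d μ ≠ 0}.Finite) := by
  -- Each nonzero `μ` is split into `d μ` labelled copies, so that multiplicity becomes cardinality.
  let S : Set (ℂ × ℕ) := {p | p.1 ≠ 0 ∧ p.2 < d p.1}
  have hfin : ∀ ε > 0, {p : ℂ × ℕ | ε ≤ ‖p.1‖ ∧ p.2 < d p.1}.Finite := fun ε hε => by
    refine ((hd ε hε).biUnion fun μ _ => (finite_Iio (d μ)).image (Prod.mk μ)).subset ?_
    rintro ⟨μ, i⟩ ⟨h1, h2⟩
    exact mem_biUnion (x := μ) ⟨h1, Nat.ne_zero_of_lt h2⟩ ⟨i, h2, rfl⟩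
  have hS : S.Countable := by
    refine (countable_iUnion fun n : ℕ => (hfin (1 / (n + 1)) (by positivity)).countable).mono ?_
    rintro p ⟨h1, h2⟩
    obtain ⟨n, hn⟩ := exists_nat_one_div_lt (norm_pos_iff.2 h1)
    exact mem_iUnion.2 ⟨n, hn.le, h2⟩
  -- When `S` is infinite the numbering is a bijection with `ℕ`. The default value `0` of `γ` is
  -- thus used only if `S` is finite, which is what the last claim asserts.
  obtain ⟨f, hf, hsurj⟩ : ∃ f : S → ℕ, f.Injective ∧ (Infinite S → f.Surjective) := by
    have : Countable S := hS
    rcases finite_or_infinite S with h | h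
    · obtain ⟨f, hf⟩ := exists_injective_nat S
      exact ⟨f, hf, fun h' => (not_finite S).elim⟩
    · obtain ⟨e⟩ := nonempty_equiv_of_countable (α := S) (β := ℕ)
      exact ⟨e, e.injective, fun _ => e.surjective⟩
  let γ : ℕ → ℂ := Function.extend f (fun p => p.1.1) 0
  have hγ : ∀ p, γ (f p) = p.1.1 := fun p => hf.extend_apply _ _ p
  have hγ' : ∀ j, γ j ≠ 0 → ∃ p, f p = j := fun j hj => by
    by_contra h
    exact hj (Function.extend_apply' _ _ _ h)
  refine ⟨γ, ?_, fun μ hμ => ?_, ?_⟩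
  · rw [Metric.tendsto_atTop']
    intro ε hε
    have h1 : {j | ε ≤ ‖γ j‖}.Finite := by
      have h2 : {p : S | ε ≤ ‖p.1.1‖}.Finite := by
        refine Finite.of_finite_image (f := Subtype.val) ((hfin ε hε).subset ?_)
          Subtype.val_injective.injOn
        rintro _ ⟨p, hp, rfl⟩
        exact ⟨hp, p.2.2⟩
      refine (h2.image f).subset fun j hj => ?_
      obtain ⟨p, rfl⟩ := hγ' j (norm_pos_iff.1 (hε.trans_le hj))
      exact ⟨p, by simpa [hγ] using hj, rfl⟩
    obtain ⟨N, hN⟩ := h1.bddAbove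
    refine ⟨N, fun n hn => ?_⟩
    by_contra h
    rw [dist_zero_right, not_lt] at h
    exact absurd (hN h) (not_le.2 hn)
  · have h1 : {j | γ j = μ} = f '' {p | p.1.1 = μ} := by
      ext j
      constructor
      · rintro rfl
        obtain ⟨p, rfl⟩ := hγ' j hμ
        exact ⟨p, (hγ p).symm, rfl⟩
      · rintro ⟨p, rfl, rfl⟩
        exact hγ p
    have h2 : Subtype.val '' {p : S | p.1.1 = μ} = Prod.mk μ '' Iio (d μ) := by
      ext ⟨ν, i⟩
      constructor
      · rintro ⟨p, rfl, h⟩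
        exact ⟨i, by have := p.2.2; rw [h] at this ⊢; exact this, by rw [h]⟩
      · rintro ⟨i, hi, h⟩
        obtain ⟨rfl, rfl⟩ := Prod.mk.inj h
        exact ⟨⟨(μ, i), hμ, hi⟩, rfl, rfl⟩
    rw [h1, hf.encard_image, ← Subtype.val_injective.encard_image, h2,
      (Prod.mk_right_injective μ).encard_image, ← Nat.card_Iio (d μ),
      ← Set.encard_coe_eq_coe_finsetCard]
    simp
  · rintro ⟨j, hj⟩
    have h1 : Finite S := by
      by_contra h
      obtain ⟨p, rfl⟩ := hsurj (not_finite_iff_infinite.1 h) j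
      exact p.2.1 (by rw [← hγ, hj])
    refine ((toFinite S).image Prod.fst).subset ?_
    rintro μ ⟨h1, h2⟩
    exact ⟨(μ, 0), ⟨h1, Nat.pos_of_ne_zero h2⟩, rfl⟩

/-- A compact self-adjoint operator with finitely many nonzero eigenvalues has finite rank. -/
theorem finiteDimensional_range [CompleteSpace E] {T : E →L[ℂ] E} (hT : IsCompactOperator T)
    (hT' : T.IsSymmetric) (hfin : {μ | μ ≠ 0 ∧ HasEigenvalue T.toLinearMap μ}.Finite) :
    FiniteDimensional ℂ (LinearMap.range T.toLinearMap) := by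
  have := hfin.to_subtype
  let V : Submodule ℂ E :=
    ⨆ μ : {μ | μ ≠ 0 ∧ HasEigenvalue T.toLinearMap μ}, eigenspace T.toLinearMap μ
  have : ∀ μ : {μ | μ ≠ 0 ∧ HasEigenvalue T.toLinearMap μ},
      FiniteDimensional ℂ (eigenspace T.toLinearMap (μ : ℂ)) := fun μ =>
    ContinuousLinearMap.finite_dimensional_eigenspace hT μ μ.2.1
  have hV : FiniteDimensional ℂ V := Submodule.finiteDimensional_iSup _
  -- The kernel goes to zero and the other nontrivial eigenspaces already lie in `V`.
  have h1 : (⨆ μ, eigenspace T.toLinearMap μ) ≤ V.comap T.toLinearMap := by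
    refine iSup_le fun μ x hx => ?_
    have hx' : T.toLinearMap x = μ • x := mem_eigenspace_iff.1 hx
    rw [Submodule.mem_comap, hx']
    by_cases h : μ ≠ 0 ∧ HasEigenvalue T.toLinearMap μ
    · exact V.smul_mem _ ((le_iSup (fun μ : {μ | μ ≠ 0 ∧ HasEigenvalue T.toLinearMap μ} =>
        eigenspace T.toLinearMap (μ : ℂ)) ⟨μ, h⟩) hx)
    · by_cases h0 : μ = 0
      · simp [h0]
      · have : x = 0 := by
          by_contra hx0
          exact h ⟨h0, hasEigenvalue_of_hasEigenvector ⟨hx, hx0⟩⟩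
        simp [this]
  have h2 : (⨆ μ, eigenspace T.toLinearMap μ).topologicalClosure = ⊤ := by
    rw [Submodule.topologicalClosure_eq_top_iff]
    exact ContinuousLinearMap.orthogonalComplement_iSup_eigenspaces_eq_bot hT hT'
  -- The eigenspaces span a dense subspace by the spectral theorem, and the preimage of the finite
  -- dimensional, hence closed, `V` is closed.
  have h3 : (⊤ : Submodule ℂ E) ≤ V.comap T.toLinearMap := by
    rw [← h2]
    refine Submodule.topologicalClosure_minimal _ h1 ?_
    exact V.closed_of_finiteDimensional.preimage T.continuous
  refine Submodule.finiteDimensional_of_le (S₂ := V) ?_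
  rintro _ ⟨x, rfl⟩
  exact h3 (Submodule.mem_top (x := x))

/-- An operator that is small on closed subspaces of finite codimension is compact. -/
theorem isCompactOperator_of_small {G : Type*} [NormedAddCommGroup G] [NormedSpace ℂ G]
    [CompleteSpace G] [CompleteSpace E] (A : E →L[ℂ] G)
    (h : ∀ ε > 0, ∃ (κ : Type) (_ : Fintype κ) (F : E →L[ℂ] (κ → ℂ)),
      ∀ u, F u = 0 → ‖A u‖ ≤ ε * ‖u‖) : IsCompactOperator A := by
  have hcl := isClosed_setOfPred_isCompactOperator (σ₁₂ := RingHom.id ℂ) (M₁ := E) (M₂ := G)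
  refine hcl.closure_subset (Metric.mem_closure_iff.2 fun ε hε => ?_)
  -- Compact operators form a closed set, so approximation suffices. With `V = ker F`, the operator
  -- `A` composed with the projection onto `Vᗮ` has finite rank, and the remainder is `A` composed
  -- with the projection onto `V`. The choice `ε / 2` makes the distance strictly less than `ε`.
  obtain ⟨κ, _, F, hF⟩ := h (ε / 2) (half_pos hε)
  let V : Submodule ℂ E := LinearMap.ker F.toLinearMap
  have hV : IsClosed (V : Set E) := F.isClosed_ker
  have : CompleteSpace V := hV.completeSpace_coe
  have hfd : FiniteDimensional ℂ Vᗮ := by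
    refine FiniteDimensional.of_injective (F.toLinearMap.domRestrict Vᗮ) ?_
    rw [← LinearMap.ker_eq_bot, Submodule.eq_bot_iff]
    intro x hx
    have h1 : (x : E) ∈ V := by simpa [V] using hx
    exact Subtype.ext (Submodule.disjoint_def.1 V.orthogonal_disjoint x h1 x.2)
  have : ProperSpace Vᗮ := FiniteDimensional.proper ℂ Vᗮ
  refine ⟨(A ∘L Vᗮ.subtypeL) ∘L Vᗮ.orthogonalProjectionOnto, ?_, ?_⟩
  · exact (isCompactOperator_of_locallyCompactSpace_rng (A ∘L Vᗮ.subtypeL)).comp_clm _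
  · rw [dist_eq_norm]
    refine lt_of_le_of_lt (ContinuousLinearMap.opNorm_le_bound _ (half_pos hε).le fun u => ?_)
      (half_lt_self hε)
    have h1 : (A - (A ∘L Vᗮ.subtypeL) ∘L Vᗮ.orthogonalProjectionOnto) u
        = A (V.orthogonalProjectionOnto u) := by
      simp only [sub_apply, ContinuousLinearMap.comp_apply, Submodule.subtypeL_apply]
      rw [← map_sub]
      congr 1
      have := V.starProjection_add_starProjection_orthogonal u
      rw [sub_eq_iff_eq_add]
      exact this.symm
    rw [h1]
    refine (hF _ (V.orthogonalProjectionOnto u).2).trans ?_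
    gcongr
    exact V.norm_orthogonalProjectionOnto_apply_le u

end CompactOperators

/-! ### Compactness of the embedding of `J_#(α, Y, ℂ³)` in `L²` -/

theorem norm_coef_le (α : E3) (f : L2Y) (n : Fin 3 → ℤ) : ‖coef α f n‖ ≤ ‖f‖ := by
  rw [← sq_le_sq₀ (norm_nonneg _) (norm_nonneg _)]
  exact le_hasSum (hasSum_coef α f) n fun m _ => by positivity

/-- A Fourier coefficient as a bounded operator. -/
def coefL (α : E3) (n : Fin 3 → ℤ) : L2Y →L[ℂ] C3 :=
  LinearMap.mkContinuous
    { toFun := fun f => coef α f n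
      map_add' := fun f g => by
        rw [coef, coef, coef, ← integral_add (integrable_conjWave α n f) (integrable_conjWave α n g)]
        refine integral_congr_ae ?_
        filter_upwards [Lp.coeFn_add f g] with x hx
        rw [hx, Pi.add_apply, smul_add]
      map_smul' := fun r f => by
        rw [RingHom.id_apply, coef, coef, ← integral_smul]
        refine integral_congr_ae ?_
        filter_upwards [Lp.coeFn_smul r f] with x hx
        rw [hx, Pi.smul_apply, smul_comm] }
    1 fun f => by rw [one_mul]; exact norm_coef_le α f n

theorem coefL_apply (α : E3) (n : Fin 3 → ℤ) (f : L2Y) : coefL α n f = coef α f n := rfl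

/-- The frequencies form a translated lattice; `|n i| ≤ |2π n i| ≤ ‖freq α n‖ + ‖α‖` confines the
indices to a box. -/
theorem finite_norm_freq_lt (α : E3) (R : ℝ) : {n : Fin 3 → ℤ | ‖freq α n‖ < R}.Finite := by
  refine (finite_Icc (fun _ => -⌈R + ‖α‖⌉ : Fin 3 → ℤ) (fun _ => ⌈R + ‖α‖⌉)).subset fun n hn => ?_
  have h : ∀ i, |(n i : ℝ)| ≤ ⌈R + ‖α‖⌉ := fun i => by
    have h1 : |freq α n i| ≤ ‖freq α n‖ :=
      (Real.norm_eq_abs _).ge.trans (PiLp.norm_apply_le _ i)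
    have h2 : |α i| ≤ ‖α‖ := (Real.norm_eq_abs _).ge.trans (PiLp.norm_apply_le _ i)
    have h3 : |2 * Real.pi * n i| ≤ |freq α n i| + |α i| := by
      have := abs_sub (freq α n i) (α i)
      simpa [freq] using this
    have h4 : |(n i : ℝ)| ≤ |2 * Real.pi * n i| := by
      rw [abs_mul, abs_of_pos Real.two_pi_pos]
      nlinarith [Real.pi_gt_three, abs_nonneg (n i : ℝ)]
    have h5 : ‖freq α n‖ < R := hn
    linarith [Int.le_ceil (R + ‖α‖)]
  refine ⟨fun i => ?_, fun i => ?_⟩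
  · have := (abs_le.1 (h i)).1
    exact_mod_cast this
  · have := (abs_le.1 (h i)).2
    exact_mod_cast this

/-- A Rellich theorem by Fourier series. If the finitely many coefficients at frequencies below
`ε⁻¹` vanish, then `norm_coef_curl` and Parseval give `‖u‖ ≤ ε ‖∇×u‖`, which is the smallness
required by `isCompactOperator_of_small`. -/
theorem isCompactOperator_toL2 (α : brillouinZone) :
    IsCompactOperator (JSpace.toL2 : JSpace α →L[ℂ] L2Y) := by
  refine isCompactOperator_of_small _ fun ε hε => ?_
  have hS := finite_norm_freq_lt α ε⁻¹
  have := hS.fintype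
  refine ⟨{n : Fin 3 → ℤ | ‖freq α n‖ < ε⁻¹} × Fin 3, inferInstance,
    ContinuousLinearMap.pi fun p =>
      (EuclideanSpace.proj p.2 : C3 →L[ℂ] ℂ) ∘L coefL α p.1 ∘L JSpace.toL2, fun u hu => ?_⟩
  have h0 : ∀ n : Fin 3 → ℤ, ‖freq α n‖ < ε⁻¹ → coef α (JSpace.field u) n = 0 := fun n hn => by
    ext i
    exact congrFun hu (⟨n, hn⟩, i)
  rw [JSpace.norm_eq, JSpace.toL2_apply, ← sq_le_sq₀ (norm_nonneg _) (by positivity), mul_pow]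
  refine hasSum_le (fun n => ?_) (hasSum_coef α (JSpace.field u))
    ((hasSum_coef α (JSpace.curl u)).mul_left (ε ^ 2))
  have h1 : ‖coef α (JSpace.curl u) n‖ ^ 2
      = ‖freq α n‖ ^ 2 * ‖coef α (JSpace.field u) n‖ ^ 2 := norm_coef_curl (JSpace.isAdmissible u) n
  rw [h1]
  by_cases hn : ‖freq α n‖ < ε⁻¹
  · simp [h0 n hn]
  · rw [← mul_assoc, ← mul_pow]
    refine le_mul_of_one_le_left (by positivity) (one_le_pow₀ ?_)
    rw [not_lt, inv_le_iff_one_le_mul₀ hε] at hn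
    linarith

/-- Elements of `JSpace` are pairs of a field and its gradient. The coefficients of the field
determine the size of those of the curl, so a zero field has zero curl and hence zero norm. -/
theorem injective_toL2 (α : brillouinZone) :
    Function.Injective (JSpace.toL2 : JSpace α →L[ℂ] L2Y) := by
  refine (injective_iff_map_eq_zero _).2 fun u hu => JSpace.eq_zero_of_curl ?_
  have h := hasSum_coef α (JSpace.curl u)
  have h1 : ∀ n, ‖coef α (JSpace.curl u) n‖ ^ 2 = 0 := fun n => by
    rw [show ‖coef α (JSpace.curl u) n‖ ^ 2 = ‖freq α n‖ ^ 2 * ‖coef α (JSpace.field u) n‖ ^ 2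
      from norm_coef_curl (JSpace.isAdmissible u) n, ← coefL_apply α n (JSpace.field u),
      ← JSpace.toL2_apply, hu]
    simp
  simp only [h1] at h
  simpa using h.unique hasSum_zero

/-! ### Plane waves -/

/-- Only countably many lattice translates occur, so a null set in the cell unfolds to a null set in
space. This permits replacing the `Lp` class of a plane wave by its formula. -/
theorem qpExt_ae_eq (α : E3) {f g : E3 → C3} (h : f =ᵐ[volume.restrict cell] g) :
    qpExt α f =ᵐ[volume] qpExt α g := by
  have h1 : ∀ m : Fin 3 → ℤ, ∀ᵐ x : E3, x - latticeVec m ∈ cell →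
      f (x - latticeVec m) = g (x - latticeVec m) := fun m =>
    (measurePreserving_sub_right volume (latticeVec m)).quasiMeasurePreserving.ae
      ((ae_restrict_iff' measurableSet_cell).1 h)
  filter_upwards [ae_all_iff.2 h1] with x hx
  have h2 : x - latticeVec (cellIndex x) ∈ cell := by
    rw [← preimage_cell (cellIndex x)]
    simp
  rw [qpExt, qpExt, hx _ h2]

/-- The plane wave `exp(i (2πn + α) · x)`. -/
def planeWave (α : E3) (n : Fin 3 → ℤ) : E3 → ℂ := conjWave (-α) (-n)

theorem freq_neg (α : E3) (n : Fin 3 → ℤ) (i : Fin 3) : freq (-α) (-n) i = -freq α n i := by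
  simp [freq]; ring

theorem conjWave_mul_planeWave (α : E3) (n : Fin 3 → ℤ) (x : E3) :
    conjWave α n x * planeWave α n x = 1 := by
  rw [planeWave, conjWave, conjWave, ← Complex.exp_add]
  simp [freq_neg]

theorem phase_mul_phase_neg (α : E3) (m : Fin 3 → ℤ) : phase α m * phase (-α) m = 1 := by
  rw [phase, phase, ← Complex.exp_add]
  simp

theorem planeWave_add (α : E3) (n m : Fin 3 → ℤ) (y : E3) :
    planeWave α n (y + latticeVec m) = phase α m * planeWave α n y := by
  rw [planeWave, ← phase_mul_conjWave (-α) (-n) m y, ← mul_assoc, phase_mul_phase_neg, one_mul]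

theorem contDiff_planeWave (α : E3) (n : Fin 3 → ℤ) : ContDiff ℝ ∞ (planeWave α n) :=
  contDiff_conjWave _ _

theorem norm_planeWave (α : E3) (n : Fin 3 → ℤ) (x : E3) : ‖planeWave α n x‖ = 1 :=
  norm_conjWave _ _ x

theorem partial_planeWave (α : E3) (n : Fin 3 → ℤ) (x : E3) (j : Fin 3) :
    fderiv ℝ (planeWave α n) x (EuclideanSpace.single j 1)
      = (I * freq α n j) * planeWave α n x := by
  rw [planeWave, partial_conjWave, freq_neg]
  push_cast
  ring

theorem memLp_planeWave (α : E3) (n : Fin 3 → ℤ) (v : C3) :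
    MemLp (fun x => planeWave α n x • v) 2 (volume.restrict cell) := by
  have := (contDiff_planeWave α n).continuous
  refine MemLp.of_bound (by fun_prop) ‖v‖ (Eventually.of_forall fun y => ?_)
  rw [norm_smul, norm_planeWave, one_mul]

/-- The vector plane wave `exp(i (2πn + α) · x) v`. -/
def planeField (α : E3) (n : Fin 3 → ℤ) (v : C3) : L2Y := (memLp_planeWave α n v).toLp _

theorem qpExt_planeField (α : E3) (n : Fin 3 → ℤ) (v : C3) :
    qpExt α (planeField α n v) =ᵐ[volume] fun x => planeWave α n x • v := by
  refine (qpExt_ae_eq α (memLp_planeWave α n v).coeFn_toLp).trans (Eventually.of_forall fun x => ?_)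
  simp only [qpExt]
  rw [smul_smul, ← planeWave_add, sub_add_cancel]

theorem planeField_smul (α : E3) (n : Fin 3 → ℤ) (v : C3) (r : ℂ) :
    r • planeField α n v = planeField α n (r • v) := by
  rw [planeField, planeField, ← MemLp.toLp_const_smul]
  refine MemLp.toLp_congr _ _ (Eventually.of_forall fun x => ?_)
  simp [smul_comm r]

/-- The quasiperiodic extension is almost everywhere a smooth function on the whole space, so
integration by parts against a compactly supported test function leaves no boundary terms. -/
theorem hasWeakPartial_planeField (α : E3) (n : Fin 3 → ℤ) (v : C3) (j : Fin 3) :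
    HasWeakPartial α (planeField α n v) j ((I * freq α n j) • planeField α n v) := by
  intro φ hφ hc
  have hw := contDiff_planeWave α n
  have hwc := hw.continuous
  have hd : ∀ x, fderiv ℝ (fun x => planeWave α n x • v) x (EuclideanSpace.single j 1)
      = planeWave α n x • (I * freq α n j) • v := fun x => by
    rw [fderiv_smul_const (hw.differentiable (by simp) x)]
    simp [partial_planeWave, smul_smul, mul_comm]
  have e1 : ∫ x, fderiv ℝ φ x (EuclideanSpace.single j 1) • qpExt α (planeField α n v) x
      = ∫ x, fderiv ℝ φ x (EuclideanSpace.single j 1) • (planeWave α n x • v) :=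
    integral_congr_ae (by filter_upwards [qpExt_planeField α n v] with x hx; rw [hx])
  have e2 : ∫ x, φ x • qpExt α ((I * freq α n j) • planeField α n v : L2Y) x
      = ∫ x, φ x • fderiv ℝ (fun x => planeWave α n x • v) x (EuclideanSpace.single j 1) := by
    rw [planeField_smul]
    exact integral_congr_ae (by
      filter_upwards [qpExt_planeField α n ((I * freq α n j) • v)] with x hx; rw [hx, hd])
  rw [e1, e2, integral_smul_fderiv_eq_neg_fderiv_smul_of_integrable, neg_neg]
  · exact Continuous.integrable_of_hasCompactSupport
      ((continuous_partial hφ j).smul (hwc.smul continuous_const))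
      (hasCompactSupport_partial hc j).smul_right
  · simp only [hd]
    exact Continuous.integrable_of_hasCompactSupport
      (hφ.continuous.smul (hwc.smul continuous_const)) hc.smul_right
  · exact Continuous.integrable_of_hasCompactSupport
      (hφ.continuous.smul (hwc.smul continuous_const)) hc.smul_right
  · exact fun x _ => hφ.differentiable (by simp) x
  · exact fun x _ => (hw.differentiable (by simp) x).smul_const v

/-- The Fourier coefficients of a plane wave vanish at the other frequencies. -/
theorem coef_planeField_of_ne (α : E3) {n m : Fin 3 → ℤ} (h : n ≠ m) (v : C3) :
    coef α (planeField α n v) m = 0 := by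
  obtain ⟨j, hj⟩ := Function.ne_iff.1 h
  -- Computing the coefficient at `m` of `∂_j` of the wave in two ways gives the factors `freq α n
  -- j` and `freq α m j`. They differ when `n j ≠ m j`, so the coefficient vanishes without
  -- evaluating an integral.
  have h1 := coef_weakPartial (hasWeakPartial_planeField α n v j) m
  rw [← coefL_apply, map_smul, coefL_apply, ← sub_eq_zero, ← sub_smul, smul_eq_zero] at h1
  refine h1.resolve_left fun h2 => hj ?_
  rw [← mul_sub, mul_eq_zero, or_iff_right I_ne_zero, sub_eq_zero, ofReal_inj] at h2
  simpa [freq, Real.pi_ne_zero] using h2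

theorem coef_planeField_self (α : E3) (n : Fin 3 → ℤ) (v : C3) :
    coef α (planeField α n v) n = (volume.real cell : ℂ) • v := by
  have h : ∫ x in cell, conjWave α n x • planeField α n v x = ∫ x in cell, v := by
    refine integral_congr_ae ?_
    filter_upwards [(memLp_planeWave α n v).coeFn_toLp] with x hx
    rw [planeField, hx, smul_smul, conjWave_mul_planeWave, one_smul]
  rw [coef, h, setIntegral_const]
  simp

theorem volume_real_cell_pos : 0 < volume.real cell := by
  have hopen : IsOpen {x : E3 | ∀ i, 0 < x i ∧ x i < 1} := by
    simp only [ofPred_forall, ofPred_and]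
    refine isOpen_iInter_of_finite fun i => IsOpen.inter ?_ ?_
    · exact isOpen_lt continuous_const (by fun_prop)
    · exact isOpen_lt (by fun_prop) continuous_const
  have h1 := hopen.measure_pos volume ⟨WithLp.toLp 2 fun _ => 1 / 2, fun i => by norm_num⟩
  have h2 : {x : E3 | ∀ i, 0 < x i ∧ x i < 1} ⊆ cell := fun x hx i => ⟨(hx i).1, (hx i).2.le⟩
  exact ENNReal.toReal_pos (h1.trans_le (measure_mono h2)).ne' volume_cell_lt_top.ne

/-- A divergence free plane wave with nonzero frequency lies in `J_#(α, Y, ℂ³)`. -/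
theorem isAdmissible_planeField (α : E3) (n : Fin 3 → ℤ) (v : C3) (hn : freq α n ≠ 0)
    (hv : ∑ j, (freq α n j : ℂ) * v j = 0) :
    IsAdmissible α (planeField α n v, fun j => (I * freq α n j) • planeField α n v) := by
  refine ⟨fun j => hasWeakPartial_planeField α n v j, ?_, ?_⟩
  · have h : ∀ j, ∀ᵐ x ∂(volume.restrict cell), ((I * freq α n j) • planeField α n v : L2Y) x j
        = I * planeWave α n x * (freq α n j * v j) := fun j => by
      rw [planeField_smul]
      filter_upwards [(memLp_planeWave α n ((I * freq α n j) • v)).coeFn_toLp] with x hx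
      rw [planeField, hx]
      simp
      ring
    filter_upwards [ae_all_iff.2 h] with x hx
    simp only [hx, ← Finset.mul_sum, hv, mul_zero]
  · intro h0
    have h1 : n ≠ 0 := by
      rintro rfl
      exact hn (by ext i; simp [freq, h0])
    -- For `α = 0` the mean over the cell is the coefficient at index `0`, which is not the index of
    -- the wave.
    have h2 := coef_planeField_of_ne α h1 v
    rw [← h2, coef]
    refine setIntegral_congr_fun measurableSet_cell fun x _ => ?_
    simp [conjWave, freq, h0]

/-- `J_#(α, Y, ℂ³)` is infinite dimensional. -/
theorem not_finiteDimensional_JSpace (α : brillouinZone) : ¬ FiniteDimensional ℂ (JSpace α) := by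
  intro hfd
  -- The shift `N + 1` and `α 0 > -π` make the first frequency component positive. The amplitude `v`
  -- is the frequency's projection to the first two axes turned by a right angle, hence orthogonal
  -- to the frequency and nonzero.
  let n : ℕ → Fin 3 → ℤ := fun N => ![N + 1, 0, 0]
  let v : ℕ → C3 := fun N => !₂[-(freq α (n N) 1 : ℂ), freq α (n N) 0, 0]
  have hpos : ∀ N, 0 < freq α (n N) 0 := fun N => by
    have h1 := (α.2 0).1
    have h2 : (0 : ℝ) ≤ 2 * Real.pi * N := by positivity
    simp only [freq, n, Matrix.cons_val_zero]
    push_cast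
    linarith [Real.pi_pos]
  have hinj : n.Injective := fun N M h => by
    have := congrFun h 0
    simp only [n, Matrix.cons_val_zero] at this
    omega
  let u : ℕ → JSpace α := fun N => ⟨(planeField α (n N) (v N), _),
    isAdmissible_planeField α (n N) (v N) (fun h => by simpa [h] using hpos N) (by
      simp only [Fin.sum_univ_three, v]
      simp
      ring)⟩
  have hu : ∀ N, JSpace.field (u N) = planeField α (n N) (v N) := fun N => rfl
  have hli : LinearIndependent ℂ u := by
    rw [linearIndependent_iff']
    intro s g hg N hN
    -- The Fourier coefficient at index `n N` isolates the single term `g N`.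
    have h1 := congrArg (fun w => coefL α (n N) (JSpace.field w)) hg
    simp only [map_sum, map_smul, hu, coefL_apply, map_zero] at h1
    rw [Finset.sum_eq_single N (fun M _ hM => by
      rw [coef_planeField_of_ne _ (hinj.ne hM), smul_zero]) (fun h => absurd hN h),
      coef_planeField_self, smul_eq_zero, smul_eq_zero] at h1
    refine h1.resolve_right fun h2 => ?_
    rcases h2 with h2 | h2
    · exact volume_real_cell_pos.ne' (by exact_mod_cast h2)
    · have h3 := congrArg (fun w : C3 => w 1) h2
      simp [v] at h3
      exact (hpos N).ne' h3
  exact not_finite_iff_infinite.2 inferInstance hli.finite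

open JSpace
open scoped ComplexOrder

namespace Crystal

open Module.End

variable (c : Crystal) (α : brillouinZone)

/-! ### Invertibility of `T_k^α` -/

/-- Host and inclusion partition the cell, so the two energies add up to the inner product. This
reduces `T_k^α` and `T^α` to affine functions of `energyOp c.host`. -/
theorem energyOp_add : (energyOp c.host : JSpace α →L[ℂ] JSpace α) + energyOp c.inclusion = 1 := by
  ext1 u
  refine ext_inner_left ℂ fun w => ?_
  rw [add_apply, inner_add_right, inner_energyOp c.host_subset c.measurableSet_host,
    inner_energyOp c.inclusion_subset c.measurableSet_inclusion, energyOn_add]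
  rfl

theorem isPositive_energyOp (S : Set E3) : (energyOp S : JSpace α →L[ℂ] JSpace α).IsPositive :=
  ContinuousLinearMap.isPositive_adjoint_comp_self _

theorem T_eq (k : ℂ) : c.T α k = 1 + (k - 1) • energyOp c.host := by
  rw [T, ← c.energyOp_add α]
  module

theorem resonanceOp_eq : c.resonanceOp α = energyOp c.host - (1 / 2 : ℂ) • 1 := by
  rw [resonanceOp, ← c.energyOp_add α]
  module

/-- The operator has the form `R* R` with `R` the curl restricted to `S`, and `R* R` has the same
kernel as `R`. Consequently `W₁` and `W₂` are the eigenspaces of `energyOp c.host` for `1` and `0`.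
-/
theorem energyOp_eq_zero {S : Set E3} (hS : S ⊆ cell) (hm : MeasurableSet S) {w : JSpace α} :
    w ∈ curlFreeIn α S hS ↔ energyOp S w = 0 := by
  have hpos := isPositive_energyOp α S
  constructor
  · intro hw
    refine ext_inner_left ℂ fun u => ?_
    rw [← hpos.isSymmetric.apply_clm, ← inner_conj_symm, inner_energyOp hS hm,
      energyOn_eq_zero α hw, map_zero, inner_zero_right]
  · intro hw
    have h1 : LpToLpRestrictCLM E3 C3 ℂ (volume.restrict cell) 2 S (curlL w) = 0 := by
      have h2 : inner ℂ w (energyOp S w) = 0 := by rw [hw, inner_zero_right]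
      rw [energyOp, ContinuousLinearMap.comp_apply, ContinuousLinearMap.adjoint_inner_right,
        inner_self_eq_zero] at h2
      exact h2
    have hr : (volume.restrict cell : Measure E3).restrict S = volume.restrict S := by
      rw [Measure.restrict_restrict hm, inter_eq_left.2 hS]
    have h3 := LpToLpRestrictCLM_coeFn ℂ (μ := volume.restrict cell) S (curlL w)
    rw [h1] at h3
    have h4 := (h3.symm.trans (Lp.coeFn_zero _ _ _))
    rw [hr] at h4
    exact h4

theorem mem_W₁ {w : JSpace α} : w ∈ c.W₁ α ↔ energyOp c.host w = w := by
  rw [W₁, energyOp_eq_zero α _ c.measurableSet_inclusion]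
  have h := congrArg (fun A : JSpace α →L[ℂ] JSpace α => A w) (c.energyOp_add α)
  simp only [add_apply, one_apply_eq_self] at h
  constructor
  · intro h0; rwa [h0, add_zero] at h
  · intro h0; rwa [h0, add_eq_left] at h

theorem mem_W₂ {w : JSpace α} : w ∈ c.W₂ α ↔ energyOp c.host w = 0 :=
  energyOp_eq_zero α _ c.measurableSet_host

/-- Eigenspaces of a symmetric operator for different eigenvalues are orthogonal. -/
theorem inner_W₁_W₂ {u w : JSpace α} (hu : u ∈ c.W₁ α) (hw : w ∈ c.W₂ α) : inner ℂ u w = 0 := by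
  rw [← (c.mem_W₁ α).1 hu, (isPositive_energyOp α c.host).isSymmetric.apply_clm,
    (c.mem_W₂ α).1 hw, inner_zero_right]

theorem completeSpace_W₁ : CompleteSpace (c.W₁ α) := by
  have : IsClosed (c.W₁ α : Set (JSpace α)) := by
    have h : (c.W₁ α : Set (JSpace α)) = {w | energyOp c.host w = w} :=
      Set.ext fun w => c.mem_W₁ α
    rw [h]
    exact isClosed_eq (energyOp c.host).continuous continuous_id
  exact this.completeSpace_coe

theorem completeSpace_W₂ : CompleteSpace (c.W₂ α) := by
  have : IsClosed (c.W₂ α : Set (JSpace α)) := by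
    have h : (c.W₂ α : Set (JSpace α)) = {w | energyOp c.host w = 0} :=
      Set.ext fun w => c.mem_W₂ α
    rw [h]
    exact isClosed_eq (energyOp c.host).continuous continuous_const
  exact this.completeSpace_coe

theorem mem_W₃ {w : JSpace α} : w ∈ c.W₃ α ↔
    (∀ u ∈ c.W₁ α, inner ℂ u w = 0) ∧ ∀ u ∈ c.W₂ α, inner ℂ u w = 0 := by
  rw [W₃, ← Submodule.inf_orthogonal, Submodule.mem_inf, Submodule.mem_orthogonal,
    Submodule.mem_orthogonal]

/-- The orthogonal decomposition of `J_#(α, Y, ℂ³)` into `W₁`, `W₂` and `W₃`. -/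
theorem exists_decomposition (u : JSpace α) :
    ∃ u₁ ∈ c.W₁ α, ∃ u₂ ∈ c.W₂ α, ∃ u₃ ∈ c.W₃ α, u = u₁ + u₂ + u₃ := by
  have := c.completeSpace_W₁ α
  have := c.completeSpace_W₂ α
  have h1 := (c.W₁ α).sub_starProjection_mem_orthogonal u
  have h2 := (c.W₂ α).sub_starProjection_mem_orthogonal u
  have m1 : (c.W₁ α).starProjection u ∈ c.W₁ α := Submodule.starProjection_apply_mem _ u
  have m2 : (c.W₂ α).starProjection u ∈ c.W₂ α := Submodule.starProjection_apply_mem _ u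
  refine ⟨_, m1, _, m2, u - (c.W₁ α).starProjection u - (c.W₂ α).starProjection u,
    (c.mem_W₃ α).2 ⟨fun w hw => ?_, fun w hw => ?_⟩, by abel⟩
  · rw [inner_sub_right, c.inner_W₁_W₂ α hw m2, (Submodule.mem_orthogonal _ _).1 h1 w hw, sub_zero]
  · rw [sub_right_comm, inner_sub_right,
      ← inner_conj_symm w ((c.W₁ α).starProjection u), c.inner_W₁_W₂ α m1 hw,
      (Submodule.mem_orthogonal _ _).1 h2 w hw, map_zero, sub_zero]

theorem T_W₁ (k : ℂ) {w : JSpace α} (hw : w ∈ c.W₁ α) : c.T α k w = k • w := by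
  rw [T_eq, add_apply, smul_apply, (c.mem_W₁ α).1 hw, one_apply_eq_self]
  module

theorem T_W₂ (k : ℂ) {w : JSpace α} (hw : w ∈ c.W₂ α) : c.T α k w = w := by
  rw [T_eq, add_apply, smul_apply, (c.mem_W₂ α).1 hw, one_apply_eq_self, smul_zero, add_zero]

/-- Substituting `energyOp c.host = T^α + 1/2` into `T_k = 1 + (k - 1) energyOp c.host` and
factoring out `1 - k` exhibits the resolvent parameter `μ = 1/(1 - k) - 1/2`, the inverse of `μ ↦ (μ
- 1/2)/(μ + 1/2)`. -/
theorem T_W₃ {k : ℂ} (hk : k ≠ 1) (w : c.W₃ α) : c.T α k w =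
    (1 - k) • ((algebraMap ℂ (c.W₃ α →L[ℂ] c.W₃ α) (1 / (1 - k) - 1 / 2) - c.resonanceOp₃ α) w :
      c.W₃ α) := by
  have h : ((c.resonanceOp₃ α w : c.W₃ α) : JSpace α) = c.resonanceOp α w := rfl
  have hk' : 1 - k ≠ 0 := sub_ne_zero.2 hk.symm
  rw [sub_apply, Submodule.coe_sub, h, resonanceOp_eq, T_eq, Algebra.algebraMap_eq_smul_one]
  simp only [add_apply, sub_apply, smul_apply, one_apply_eq_self, Submodule.coe_smul]
  match_scalars <;> field_simp <;> ring

/-- All three diagonal blocks of `T_k^α` are bijective: `k ≠ 0` handles `W₁`, `W₂` carries the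
identity, and on `W₃` the point `μ` avoids the spectrum. The bounded inverse theorem then yields a
unit. -/
theorem isUnit_T {k : ℂ} (hk : k ∉ c.Z α) : IsUnit (c.T α k) := by
  -- At `k = 1` the parameter `μ` is infinite, but `T_k^α` is the identity.
  by_cases hk1 : k = 1
  · have h : c.T α k = 1 := by
      ext1 u
      simp [hk1, T_eq]
    rw [h]
    exact isUnit_one
  have hk' : 1 - k ≠ 0 := sub_ne_zero.2 (Ne.symm hk1)
  have hk0 : k ≠ 0 := by
    rintro rfl
    exact hk ⟨1 / 2, mem_insert _ _, by norm_num, by norm_num⟩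
  have hres : IsUnit (algebraMap ℂ (c.W₃ α →L[ℂ] c.W₃ α) (1 / (1 - k) - 1 / 2)
      - c.resonanceOp₃ α) := by
    by_contra h
    -- The exclusion `μ ≠ -1/2` costs nothing here, since `μ + 1/2 = 1/(1 - k)` never vanishes.
    refine hk ⟨1 / (1 - k) - 1 / 2, mem_insert_of_mem _ h, fun h0 => ?_, ?_⟩
    · have : 1 / (1 - k) = 0 := by linear_combination h0
      exact one_div_ne_zero hk' this
    · field_simp
      ring
  have hcl : IsClosed (c.W₃ α : Set (JSpace α)) := Submodule.isClosed_orthogonal _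
  have : CompleteSpace (c.W₃ α) := hcl.completeSpace_coe
  set R := algebraMap ℂ (c.W₃ α →L[ℂ] c.W₃ α) (1 / (1 - k) - 1 / 2) - c.resonanceOp₃ α
  obtain ⟨hinj, hsurj⟩ := ContinuousLinearMap.isUnit_iff_bijective.1 hres
  refine ContinuousLinearMap.isUnit_iff_bijective.2
    ⟨(injective_iff_map_eq_zero _).2 fun u hu => ?_, fun u => ?_⟩
  · obtain ⟨u₁, h₁, u₂, h₂, u₃, h₃, rfl⟩ := c.exists_decomposition α u
    have e3 : c.T α k u₃ = (1 - k) • (R ⟨u₃, h₃⟩ : c.W₃ α) := c.T_W₃ α hk1 ⟨u₃, h₃⟩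
    rw [map_add, map_add, T_W₁ c α k h₁, T_W₂ c α k h₂, e3] at hu
    obtain ⟨o1, o2⟩ := (c.mem_W₃ α).1 (R ⟨u₃, h₃⟩).2
    -- Pairing the equation with `u₁` and then with `u₂` separates the orthogonal components.
    have z1 : u₁ = 0 := by
      have := congrArg (inner ℂ u₁) hu
      simp only [inner_add_right, inner_smul_right, c.inner_W₁_W₂ α h₁ h₂, o1 u₁ h₁, mul_zero,
        add_zero, inner_zero_right, mul_eq_zero, hk0, false_or] at this
      exact inner_self_eq_zero.1 this
    have z2 : u₂ = 0 := by
      have := congrArg (inner ℂ u₂) hu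
      simp only [z1, smul_zero, zero_add, inner_add_right, inner_smul_right, o2 u₂ h₂, mul_zero,
        add_zero, inner_zero_right] at this
      exact inner_self_eq_zero.1 this
    rw [z1, z2, smul_zero, zero_add, zero_add, smul_eq_zero, or_iff_right hk',
      Submodule.coe_eq_zero] at hu
    have z3 : (⟨u₃, h₃⟩ : c.W₃ α) = 0 := hinj (hu.trans (map_zero R).symm)
    rw [z1, z2, show u₃ = 0 from congrArg Subtype.val z3, add_zero, add_zero]
  · obtain ⟨u₁, h₁, u₂, h₂, u₃, h₃, rfl⟩ := c.exists_decomposition α u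
    obtain ⟨w, hw⟩ := hsurj ⟨u₃, h₃⟩
    refine ⟨k⁻¹ • u₁ + u₂ + (1 - k)⁻¹ • (w : JSpace α), ?_⟩
    rw [map_add, map_add, map_smul, map_smul, T_W₁ c α k h₁, T_W₂ c α k h₂, T_W₃ c α hk1, hw,
      inv_smul_smul₀ hk0, inv_smul_smul₀ hk']

/-! ### Spectral bounds for the resonance operator and the location of `Z` -/

/-- On `W₃` the operators `T^α + 1/2` and `1/2 - T^α` are the restrictions of the host and inclusion
energy operators, so positivity is inherited. This theorem and the next give the lower and upper
bounds for `T^α`. -/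
theorem isPositive_resonanceOp₃_add : (c.resonanceOp₃ α + (1 / 2 : ℂ) • 1).IsPositive := by
  have h : ∀ u : c.W₃ α, (((c.resonanceOp₃ α + (1 / 2 : ℂ) • 1) u : c.W₃ α) : JSpace α)
      = energyOp c.host (u : JSpace α) := fun u => by
    change c.resonanceOp α u + (1 / 2 : ℂ) • (u : JSpace α) = _
    rw [resonanceOp_eq]
    simp
  have hp := isPositive_energyOp α c.host
  refine ⟨fun u w => ?_, fun u => ?_⟩
  · change inner ℂ (((c.resonanceOp₃ α + (1 / 2 : ℂ) • 1) u : c.W₃ α) : JSpace α) (w : JSpace α)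
      = inner ℂ (u : JSpace α) (((c.resonanceOp₃ α + (1 / 2 : ℂ) • 1) w : c.W₃ α) : JSpace α)
    rw [h, h]
    exact hp.isSymmetric _ _
  · change 0 ≤ RCLike.re (inner ℂ (((c.resonanceOp₃ α + (1 / 2 : ℂ) • 1) u : c.W₃ α) : JSpace α)
      (u : JSpace α))
    rw [h]
    exact hp.re_inner_nonneg_left _

theorem isPositive_sub_resonanceOp₃ : ((1 / 2 : ℂ) • 1 - c.resonanceOp₃ α).IsPositive := by
  have h : ∀ u : c.W₃ α, ((((1 / 2 : ℂ) • 1 - c.resonanceOp₃ α) u : c.W₃ α) : JSpace α)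
      = energyOp c.inclusion (u : JSpace α) := fun u => by
    change (1 / 2 : ℂ) • (u : JSpace α) - c.resonanceOp α u = _
    have h1 := congrArg (fun A : JSpace α →L[ℂ] JSpace α => A u) (c.energyOp_add α)
    simp only [add_apply, one_apply_eq_self] at h1
    rw [resonanceOp_eq, sub_apply, smul_apply, one_apply_eq_self, eq_sub_of_add_eq' h1]
    module
  have hp := isPositive_energyOp α c.inclusion
  refine ⟨fun u w => ?_, fun u => ?_⟩
  · change inner ℂ ((((1 / 2 : ℂ) • 1 - c.resonanceOp₃ α) u : c.W₃ α) : JSpace α) (w : JSpace α)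
      = inner ℂ (u : JSpace α) ((((1 / 2 : ℂ) • 1 - c.resonanceOp₃ α) w : c.W₃ α) : JSpace α)
    rw [h, h]
    exact hp.isSymmetric _ _
  · change 0 ≤ RCLike.re (inner ℂ ((((1 / 2 : ℂ) • 1 - c.resonanceOp₃ α) u : c.W₃ α) : JSpace α)
      (u : JSpace α))
    rw [h]
    exact hp.re_inner_nonneg_left _

end Crystal

/-- The spectrum of a positive operator consists of nonnegative real numbers. -/
theorem nonneg_of_mem_spectrum {H : Type*} [NormedAddCommGroup H] [InnerProductSpace ℂ H]
    [CompleteSpace H] {A : H →L[ℂ] H} (hA : A.IsPositive) {z : ℂ} (hz : z ∈ spectrum ℂ A) :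
    z.im = 0 ∧ 0 ≤ z.re := by
  have h0 : (0 : H →L[ℂ] H) ≤ A := (ContinuousLinearMap.nonneg_iff_isPositive A).2 hA
  have := spectrum_nonneg_of_nonneg h0 hz
  exact ⟨(Complex.nonneg_iff.1 this).2.symm, (Complex.nonneg_iff.1 this).1⟩

/-- The numbers `μ + 1/2` and `1/2 - μ` lie in the spectra of the two positive operators. -/
theorem mem_segment_of_mem_spectrum {H : Type*} [NormedAddCommGroup H] [InnerProductSpace ℂ H]
    [CompleteSpace H] {A : H →L[ℂ] H} (h₁ : (A + (1 / 2 : ℂ) • 1).IsPositive)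
    (h₂ : ((1 / 2 : ℂ) • 1 - A).IsPositive) {μ : ℂ} (h : μ ∈ spectrum ℂ A) :
    μ.im = 0 ∧ -(1 / 2) ≤ μ.re ∧ μ.re ≤ 1 / 2 := by
  rw [← Algebra.algebraMap_eq_smul_one] at h₁ h₂
  rw [spectrum.mem_iff] at h
  have h3 : μ + 1 / 2 ∈ spectrum ℂ (A + algebraMap ℂ (H →L[ℂ] H) (1 / 2)) := by
    rwa [spectrum.mem_iff, map_add, add_sub_add_right_eq_sub]
  have h4 : 1 / 2 - μ ∈ spectrum ℂ (algebraMap ℂ (H →L[ℂ] H) (1 / 2) - A) := by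
    rwa [spectrum.mem_iff, map_sub, sub_sub_sub_cancel_left, ← neg_sub, IsUnit.neg_iff]
  replace h3 := nonneg_of_mem_spectrum h₁ h3
  replace h4 := nonneg_of_mem_spectrum h₂ h4
  simp at h3 h4
  exact ⟨h3.1, by linarith, by linarith⟩

namespace Crystal

open Module.End

variable (c : Crystal) (α : brillouinZone)

theorem mem_spectrum_resonanceOp₃ {μ : ℂ} (h : μ ∈ spectrum ℂ (c.resonanceOp₃ α)) :
    μ.im = 0 ∧ -(1 / 2) ≤ μ.re ∧ μ.re ≤ 1 / 2 := by
  have hcl : IsClosed (c.W₃ α : Set (JSpace α)) := Submodule.isClosed_orthogonal _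
  have : CompleteSpace (c.W₃ α) := hcl.completeSpace_coe
  exact mem_segment_of_mem_spectrum (c.isPositive_resonanceOp₃_add α)
    (c.isPositive_sub_resonanceOp₃ α) h

/-- The map `μ ↦ (μ - 1/2)/(μ + 1/2)` has nonpositive numerator and positive denominator on `(-1/2,
1/2]`. -/
theorem Z_subset : c.Z α ⊆ {k : ℂ | k.im = 0 ∧ k.re ≤ 0} := by
  rintro _ ⟨μ, hμ, hne, rfl⟩
  have h : μ.im = 0 ∧ -(1 / 2) ≤ μ.re ∧ μ.re ≤ 1 / 2 := by
    rcases hμ with rfl | hμ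
    · norm_num
    · exact c.mem_spectrum_resonanceOp₃ α hμ
  obtain ⟨r, rfl⟩ : ∃ r : ℝ, μ = r := ⟨μ.re, Complex.ext rfl (by simp [h.1])⟩
  have h1 : ((r : ℂ) - 1 / 2) / (r + 1 / 2) = (((r - 1 / 2) / (r + 1 / 2) : ℝ) : ℂ) := by
    push_cast
    rfl
  rw [h1]
  simp only [ofReal_re] at h
  exact ⟨ofReal_im _, div_nonpos_of_nonpos_of_nonneg (by linarith) (by linarith)⟩

/-! ### The operator `B^α(k)` -/

theorem T_comp_inverse {k : ℂ} (hk : k ∉ c.Z α) (u : JSpace α) :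
    c.T α k (Ring.inverse (c.T α k) u) = u := by
  have := Ring.mul_inverse_cancel _ (c.isUnit_T α hk)
  exact congrArg (fun A : JSpace α →L[ℂ] JSpace α => A u) this

theorem inverse_comp_T {k : ℂ} (hk : k ∉ c.Z α) (u : JSpace α) :
    Ring.inverse (c.T α k) (c.T α k u) = u := by
  have := Ring.inverse_mul_cancel _ (c.isUnit_T α hk)
  exact congrArg (fun A : JSpace α →L[ℂ] JSpace α => A u) this

theorem isCompactOperator_B (k : ℂ) : IsCompactOperator (c.B α k) :=
  (isCompactOperator_toL2 α).comp_clm (Ring.inverse (c.T α k) ∘L invLaplacian α)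

/-- `T_k^α` is affine in `k`, inversion is analytic at a unit, and `B^α(k)` is the image of the
inverse under a fixed bounded linear map, called `L` below. -/
theorem analyticAt_B {k : ℂ} (hk : k ∉ c.Z α) : AnalyticAt ℂ (fun k' : ℂ => c.B α k') k := by
  obtain ⟨U, hU⟩ := c.isUnit_T α hk
  have h1 : AnalyticAt ℂ (fun k' : ℂ => c.T α k') k := by
    have h3 := ((ContinuousLinearMap.toSpanSingleton ℂ
      (energyOp c.host : JSpace α →L[ℂ] JSpace α)).analyticAt k).add
      (analyticAt_const (v := energyOp c.inclusion))
    exact h3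
  have h2 : AnalyticAt ℂ (fun k' : ℂ => Ring.inverse (c.T α k')) k := by
    refine AnalyticAt.fun_comp ?_ h1
    rw [← hU]
    exact analyticAt_inverse U
  let L : (JSpace α →L[ℂ] JSpace α) →L[ℂ] (L2Y →L[ℂ] L2Y) :=
    ContinuousLinearMap.compL ℂ L2Y (JSpace α) L2Y toL2 ∘L
      (ContinuousLinearMap.compL ℂ L2Y (JSpace α) (JSpace α)).flip (invLaplacian α)
  exact (L.analyticAt _).fun_comp h2

/-! ### Bloch waves -/

/-- Both sides of the weak equation are inner products in `J_#` with the test field `w`, so the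
equation is an identity between vectors. -/
theorem mem_blochSpace_iff {k ξ : ℂ} {h : JSpace α} :
    h ∈ c.blochSpace α k ξ ↔ c.T α k h = ξ • invLaplacian α (toL2 h) := by
  change (∀ w, c.form α k h w = ξ * pairing h w) ↔ _
  refine Iff.trans (forall_congr' fun w => ?_) (ext_iff_inner_left ℂ).symm
  rw [inner_T, inner_smul_right, inner_invLaplacian, inner_toL2]

theorem blochSpace_zero {k : ℂ} (hk : k ∉ c.Z α) : c.blochSpace α k 0 = ⊥ := by
  rw [Submodule.eq_bot_iff]
  intro h hh
  rw [mem_blochSpace_iff, zero_smul] at hh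
  rw [← c.inverse_comp_T α hk h, hh, map_zero]

/-- Applying `(T_k^α)⁻¹` turns the Bloch equation into `h = ξ B^α(k) h`. Conversely an eigenvector
`f = ξ B^α(k) f` is automatically a field in `J_#`, represented by `ξ (T_k^α)⁻¹ (-Δ_α)⁻¹ f`. -/
theorem map_blochSpace {k : ℂ} (hk : k ∉ c.Z α) {ξ : ℂ} (hξ : ξ ≠ 0) :
    (c.blochSpace α k ξ).map (toL2 (α := α)).toLinearMap
      = eigenspace (c.B α k).toLinearMap ξ⁻¹ := by
  ext f
  rw [mem_eigenspace_iff]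
  constructor
  · rintro ⟨h, hh, rfl⟩
    rw [SetLike.mem_coe, mem_blochSpace_iff] at hh
    change toL2 (Ring.inverse (c.T α k) (invLaplacian α (toL2 h))) = ξ⁻¹ • toL2 h
    rw [eq_inv_smul_iff₀ hξ, ← map_smul, ← map_smul, ← hh, c.inverse_comp_T α hk]
  · intro hf
    change toL2 (Ring.inverse (c.T α k) (invLaplacian α f)) = ξ⁻¹ • f at hf
    rw [eq_inv_smul_iff₀ hξ, ← map_smul] at hf
    refine ⟨ξ • Ring.inverse (c.T α k) (invLaplacian α f), ?_, hf⟩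
    rw [SetLike.mem_coe, mem_blochSpace_iff, hf, map_smul, c.T_comp_inverse α hk]

/-- A Bloch space is isomorphic to an eigenspace of `B^α(k)`. -/
def blochEquiv {k : ℂ} (hk : k ∉ c.Z α) {ξ : ℂ} (hξ : ξ ≠ 0) :
    c.blochSpace α k ξ ≃ₗ[ℂ] eigenspace (c.B α k).toLinearMap ξ⁻¹ :=
  (Submodule.equivMapOfInjective _ (injective_toL2 α) _).trans
    (LinearEquiv.ofEq _ _ (c.map_blochSpace α hk hξ))

/-! ### Real coupling constants: symmetry, infinite rank and positivity -/

theorem isSymmetric_T {k : ℂ} (him : k.im = 0) : (c.T α k).IsSymmetric := by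
  intro u w
  have h1 := (isPositive_energyOp α c.host).isSymmetric u w
  have h2 : conj k = k := Complex.conj_eq_iff_im.2 him
  simp only [ContinuousLinearMap.coe_coe] at h1 ⊢
  rw [T_eq]
  simp only [add_apply, smul_apply, one_apply_eq_self, inner_add_left, inner_add_right,
    inner_smul_left, inner_smul_right, map_sub, map_one, h1, h2]

/-- `B^α(k)` has the form `A S A*` with `A = toL2`, where `S` is the inverse of a symmetric operator
and hence symmetric. -/
theorem isSymmetric_B {k : ℂ} (hk : k ∉ c.Z α) (him : k.im = 0) : (c.B α k).IsSymmetric := by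
  have hS : ∀ u w : JSpace α, inner ℂ (Ring.inverse (c.T α k) u) w
      = inner ℂ u (Ring.inverse (c.T α k) w) := fun u w => by
    have := c.isSymmetric_T α him (Ring.inverse (c.T α k) u) (Ring.inverse (c.T α k) w)
    simp only [ContinuousLinearMap.coe_coe] at this
    rw [c.T_comp_inverse α hk, c.T_comp_inverse α hk] at this
    exact this.symm
  intro f g
  change inner ℂ (toL2 (Ring.inverse (c.T α k) (invLaplacian α f))) g
    = inner ℂ f (toL2 (Ring.inverse (c.T α k) (invLaplacian α g)))
  rw [← inner_invLaplacian, hS, ← inner_conj_symm f, ← inner_invLaplacian, inner_conj_symm]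

/-- `toL2 ∘ (T_k^α)⁻¹` is injective, so finite rank of `B^α(k)` would pass to `(-Δ_α)⁻¹`. As the
adjoint of an injective map, the latter has dense range; a finite dimensional dense range would be
all of `J_#`. -/
theorem not_finiteDimensional_range_B {k : ℂ} (hk : k ∉ c.Z α) :
    ¬ FiniteDimensional ℂ (LinearMap.range (c.B α k).toLinearMap) := by
  intro hfd
  have hinj : Function.Injective (toL2 ∘L Ring.inverse (c.T α k) : JSpace α →L[ℂ] L2Y) :=
    (injective_toL2 α).comp (Function.LeftInverse.injective (c.T_comp_inverse α hk))
  have hr : LinearMap.range (c.B α k).toLinearMap = (LinearMap.range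
      (invLaplacian α).toLinearMap).map (toL2 ∘L Ring.inverse (c.T α k)).toLinearMap := by
    rw [← LinearMap.range_comp]
    rfl
  rw [hr] at hfd
  have h1 : FiniteDimensional ℂ (LinearMap.range (invLaplacian α).toLinearMap) :=
    LinearEquiv.finiteDimensional (Submodule.equivMapOfInjective _ hinj _).symm
  have h2 : LinearMap.range (invLaplacian α).toLinearMap = ⊤ := by
    rw [← Submodule.orthogonal_eq_bot_iff, Submodule.eq_bot_iff]
    intro u hu
    have h3 := (Submodule.mem_orthogonal' _ _).1 hu (invLaplacian α (toL2 u)) ⟨_, rfl⟩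
    rw [inner_invLaplacian, inner_self_eq_zero] at h3
    exact injective_toL2 α (h3.trans (map_zero _).symm)
  rw [h2] at h1
  exact not_finiteDimensional_JSpace α (LinearEquiv.finiteDimensional Submodule.topEquiv)

/-- The Bloch eigenvalues are positive for positive coupling constants. -/
theorem pos_of_mem_blochSpace {k ξ : ℂ} (him : k.im = 0) (hre : 0 < k.re) {h : JSpace α}
    (hh : h ∈ c.blochSpace α k ξ) (h0 : h ≠ 0) : ξ.im = 0 ∧ 0 < ξ.re := by
  obtain ⟨r, rfl⟩ : ∃ r : ℝ, k = r := ⟨k.re, Complex.ext rfl (by simp [him])⟩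
  rw [ofReal_re] at hre
  have hpos : ∀ S : Set E3, ∃ t : ℝ, 0 ≤ t ∧ inner ℂ h (energyOp S h) = t := fun S => by
    have := (isPositive_energyOp α S).inner_nonneg_right h
    exact ⟨_, (Complex.nonneg_iff.1 this).1, Complex.ext rfl (Complex.nonneg_iff.1 this).2.symm⟩
  obtain ⟨a, ha, ha'⟩ := hpos c.host
  obtain ⟨b, hb, hb'⟩ := hpos c.inclusion
  have hab : a + b = ‖h‖ ^ 2 := by
    have h1 := congrArg (fun A : JSpace α →L[ℂ] JSpace α => inner ℂ h (A h)) (c.energyOp_add α)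
    simp only [add_apply, one_apply_eq_self, inner_add_right, ha', hb',
      inner_self_eq_norm_sq_to_K] at h1
    exact ofReal_injective (by push_cast; exact h1)
  have hsum : 0 < a + b := by rw [hab]; positivity
  -- Host and inclusion energies are nonnegative and not both zero, so a positive weight on the host
  -- keeps the sum positive.
  have hT : 0 < r * a + b := by
    rcases ha.eq_or_lt with h | h
    · rw [← h, zero_add] at hsum; rw [← h]; linarith
    · nlinarith [mul_pos hre h]
  have hL : 0 < ‖toL2 h‖ ^ 2 := by
    have : toL2 h ≠ 0 := fun h1 => h0 (injective_toL2 α (h1.trans (map_zero _).symm))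
    positivity
  -- Testing the equation with `h` itself expresses `ξ` as a Rayleigh quotient.
  have key : ((r * a + b : ℝ) : ℂ) = ξ * ((‖toL2 h‖ ^ 2 : ℝ) : ℂ) := by
    have h1 := congrArg (inner ℂ h) ((c.mem_blochSpace_iff α).1 hh)
    rw [inner_smul_right, inner_invLaplacian, inner_self_eq_norm_sq_to_K, T, add_apply, smul_apply,
      inner_add_right, inner_smul_right, ha', hb'] at h1
    push_cast
    exact h1
  have h2 : ξ = (((r * a + b) / ‖toL2 h‖ ^ 2 : ℝ) : ℂ) := by
    rw [ofReal_div, key, mul_div_cancel_right₀]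
    exact_mod_cast hL.ne'
  rw [h2]
  exact ⟨ofReal_im _, div_pos hT hL⟩

/-! ### The sequence of eigenvalues -/

theorem exists_eigenvalue_sequence {k : ℂ} (hk : k ∉ c.Z α) : ∃ γ : ℕ → ℂ,
    Tendsto γ atTop (𝓝 0) ∧
    spectrum ℂ (c.B α k) \ {0} = range γ \ {0} ∧
    (∀ ξ : ℂ, FiniteDimensional ℂ (c.blochSpace α k ξ) ∧
      {j : ℕ | γ j ≠ 0 ∧ (γ j)⁻¹ = ξ}.encard = (Module.finrank ℂ (c.blochSpace α k ξ) : ℕ∞)) ∧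
    (k.im = 0 → 0 < k.re → ∀ j : ℕ, (γ j).im = 0 ∧ 0 < (γ j).re) := by
  have hB := c.isCompactOperator_B α k
  have hfd : ∀ μ ≠ 0, FiniteDimensional ℂ (eigenspace (c.B α k).toLinearMap μ) := fun μ hμ =>
    ContinuousLinearMap.finite_dimensional_eigenspace hB μ hμ
  -- The value at `0`, where the eigenspace may be infinite dimensional, plays no role: the
  -- enumeration only counts nonzero points.
  let d : ℂ → ℕ := fun μ => Module.finrank ℂ (eigenspace (c.B α k).toLinearMap μ)
  have hd : ∀ μ ≠ 0, d μ ≠ 0 ↔ HasEigenvalue (c.B α k).toLinearMap μ := fun μ hμ => by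
    have := hfd μ hμ
    rw [hasEigenvalue_iff, Ne, Ne, Submodule.finrank_eq_zero]
  obtain ⟨γ, hlim, hcard, hzero⟩ := exists_enumeration d fun ε hε =>
    (finite_hasEigenvalue hB hε).subset fun μ hμ =>
      ⟨hμ.1, (hd μ (norm_pos_iff.1 (hε.trans_le hμ.1))).1 hμ.2⟩
  have hmem : ∀ μ ≠ 0, μ ∈ range γ ↔ HasEigenvalue (c.B α k).toLinearMap μ := fun μ hμ => by
    rw [← hd μ hμ, ← Nat.cast_ne_zero (R := ℕ∞), ← hcard μ hμ, encard_ne_zero]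
    rfl
  have hbloch : ∀ ξ ≠ 0, FiniteDimensional ℂ (c.blochSpace α k ξ) := fun ξ hξ => by
    have := hfd ξ⁻¹ (inv_ne_zero hξ)
    exact LinearEquiv.finiteDimensional (c.blochEquiv α hk hξ).symm
  refine ⟨γ, hlim, ?_, fun ξ => ?_, fun him hre j => ?_⟩
  · ext μ
    simp only [Set.mem_sdiff, mem_singleton_iff]
    -- By the Fredholm alternative, nonzero spectral points of a compact operator are eigenvalues.
    exact and_congr_left fun hμ => by rw [hmem μ hμ, ← hB.hasEigenvalue_iff_mem_spectrum hμ]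
  · by_cases hξ : ξ = 0
    · subst hξ
      rw [c.blochSpace_zero α hk]
      refine ⟨inferInstance, ?_⟩
      have : {j : ℕ | γ j ≠ 0 ∧ (γ j)⁻¹ = 0} = ∅ := by
        ext j; simp
      rw [this, finrank_bot]
      simp
    · refine ⟨hbloch ξ hξ, ?_⟩
      have : {j : ℕ | γ j ≠ 0 ∧ (γ j)⁻¹ = ξ} = {j | γ j = ξ⁻¹} := by
        ext j
        constructor
        · rintro ⟨_, rfl⟩; simp
        · intro h
          change γ j = ξ⁻¹ at h
          simp [h, hξ]
      rw [this, hcard _ (inv_ne_zero hξ), (c.blochEquiv α hk hξ).finrank_eq]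
  -- A zero entry would leave only finitely many nonzero eigenvalues, forcing the symmetric compact
  -- operator `B^α(k)` to have finite rank.
  · have hj : γ j ≠ 0 := fun h => by
      refine c.not_finiteDimensional_range_B α hk
        (finiteDimensional_range hB (c.isSymmetric_B α hk him) ?_)
      exact (hzero ⟨j, h⟩).subset fun μ hμ => ⟨hμ.1, (hd μ hμ.1).2 hμ.2⟩
    obtain ⟨f, hf⟩ := ((hmem _ hj).1 ⟨j, rfl⟩).exists_hasEigenvector
    have hf1 : f ∈ eigenspace (c.B α k).toLinearMap (γ j)⁻¹⁻¹ := by rw [inv_inv]; exact hf.1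
    rw [← c.map_blochSpace α hk (inv_ne_zero hj)] at hf1
    obtain ⟨h, hh, rfl⟩ := hf1
    have h0 : h ≠ 0 := by
      rintro rfl
      exact hf.2 (map_zero _)
    obtain ⟨h1, h2⟩ := c.pos_of_mem_blochSpace α him hre hh h0
    obtain ⟨r, hr⟩ : ∃ r : ℝ, (γ j)⁻¹ = r := ⟨(γ j)⁻¹.re, Complex.ext rfl (by simp [h1])⟩
    have h3 : γ j = ((r⁻¹ : ℝ) : ℂ) := by rw [ofReal_inv, ← hr, inv_inv]
    rw [hr, ofReal_re] at h2
    rw [h3]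
    exact ⟨ofReal_im _, inv_pos.2 h2⟩

end Crystal

end BlochWaves

end

theorem mainTheorem5 (c : BlochWaves.Crystal) (α : BlochWaves.brillouinZone) :
    c.Z α ⊆ {k : ℂ | k.im = 0 ∧ k.re ≤ 0} ∧
    ∃ γ : ℂ → ℕ → ℂ, ∀ k : ℂ, k ∉ c.Z α →
      IsUnit (c.T α k) ∧
      IsCompactOperator (c.B α k) ∧
      AnalyticAt ℂ (fun k' : ℂ => c.B α k') k ∧
      Filter.Tendsto (γ k) Filter.atTop (nhds 0) ∧
      spectrum ℂ (c.B α k) \ {0} = Set.range (γ k) \ {0} ∧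
      c.blochSpace α k 0 = ⊥ ∧
      (∀ ξ : ℂ, ξ ≠ 0 →
        (c.blochSpace α k ξ).map (BlochWaves.JSpace.toL2 (α := α)).toLinearMap =
          Module.End.eigenspace (c.B α k).toLinearMap ξ⁻¹) ∧
      (∀ ξ : ℂ, FiniteDimensional ℂ (c.blochSpace α k ξ) ∧
        {j : ℕ | γ k j ≠ 0 ∧ (γ k j)⁻¹ = ξ}.encard =
          (Module.finrank ℂ (c.blochSpace α k ξ) : ℕ∞)) ∧
      (k.im = 0 → 0 < k.re → ∀ j : ℕ, (γ k j).im = 0 ∧ 0 < (γ k j).re) := by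
  classical
  -- The sequence is chosen separately for each `k`; the value `0` on `Z` is a filler.
  refine ⟨c.Z_subset α, fun k => if hk : k ∉ c.Z α then
    (c.exists_eigenvalue_sequence α hk).choose else 0, fun k hk => ?_⟩
  obtain ⟨h1, h2, h3, h4⟩ := (c.exists_eigenvalue_sequence α hk).choose_spec
  simp only [dif_pos hk]
  exact ⟨c.isUnit_T α hk, c.isCompactOperator_B α k, c.analyticAt_B α hk, h1, h2,
    c.blochSpace_zero α hk, fun ξ hξ => c.map_blochSpace α hk hξ, h3, h4⟩
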